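/- All matroids here are finite, and $r$ denotes the rank function. A matroid $M$ is connected if $\emptyset$ and $M$ are the only sets $F\subseteq M$ with $r(F)+r(M\setminus F)=r(M)$; a component of $M$ is an inclusion-wise maximal nonempty set $F\subseteq M$ such that $M|F$ is connected. For a rooted tree $T$, $\|T\|$ denotes its number of edges, and its depth is the length of a longest path from the root to a leaf. A depth-decomposition of $M$ is a pair $(T,f)$ of a rooted tree $T$ and a map $f:M\to V(T)$ such that $r(M)=\|T\|$ and $r(X)\le\|T^*(X)\|$ for every $X\subseteq M$, where $T^*(X)$ is the union of the paths from the root to the vertices in $f(X)$. The branch-depth $\mathrm{bd}(M)$ is the smallest depth of a rooted tree $T$ over all depth-decompositions $(T,f)$ of $M$. Consider the following recursive routine $\mathrm{construct}(M,C,e)$. Its input is a connected matroid $M$, a circuit $C$ of $M$ and a non-loop element $e\in C$; if $M$ has a single element, $C$ and $e$ are irrelevant and may be arbitrary. 0. If $r(M)=0$, return the one-vertex tree, with all elements mapped to the root. 1. If $r(M)=1$, return the one-edge tree, with all elements mapped to the leaf (the non-root vertex). 2. If $r(M)\ge 2$ and $|C|=2$, choose a circuit $C'$ of $M$ with $|C'|\ge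 3$ and $e\in C'$, and return $\mathrm{construct}(M,C',e)$. 3. If $r(M)\ge 2$, $|C|\neq 2$ and $M/e$ is connected, choose $e_1\in C\setminus\{e\}$ and let $(T',f')=\mathrm{construct}(M/e,C\setminus\{e\},e_1)$. Return the tree obtained from $T'$ by adding a new root joined to the root $v'$ of $T'$, with $f(e)=v'$ and $f(x)=f'(x)$ for $x\ne e$. 4. If $r(M)\ge 2$, $|C|\ne 2$ and $M/e$ is not connected, proceed as follows for every component $M_i$ of $M/e$. If $M_i$ contains $C\setminus\{e\}$, choose $e_i\in C\setminus\{e\}$ and let $(T_i,f_i)=\mathrm{construct}((M/e)|M_i,C\setminus\{e\},e_i)$. If $M_i$ is disjoint from $C$, choose a circuit $C_i$ of $M$ with $e\in C_i\subseteq M_i\cup\{e\}$, choose $e_i\in C_i\setminus\{e\}$, and let $(T_i,f_i)=\mathrm{construct}((M/e)|M_i,C_i\setminus\{e\},e_i)$. Identify the roots of all the trees $T_i$ into one vertex $v'$ and add a new root joined to $v'$; return the resulting tree with $f(e)=v'$ and $f(x)=f_i(x)$ for $x\in M_i$. For an arbitrary matroid $M$, the algorithm runs $\mathrm{construct}(M|F,C_F,e_F)$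 for each component $F$ of $M$, with any admissible $C_F$ and $e_F$, and identifies the roots of the resulting trees (obtaining the one-vertex tree if $M$ is empty). **Lemma.** For every finite connected matroid $M$ and every admissible input $(M,C,e)$, the routine $\mathrm{construct}(M,C,e)$ always terminates without getting stuck, whatever choices are made, and every pair $(T,f)$ that it can return is a depth-decomposition of $M$ of depth at most $4^{\mathrm{bd}(M)}$. Likewise, for every finite matroid $M$, connected or not, the algorithm that processes the components of $M$ can return a pair, and every pair $(T,f)$ that it can return is a depth-decomposition of $M$ of depth at most $4^{\mathrm{bd}(M)}$. -/

import Mathlib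

universe u

namespace BranchDepth

/-- A finite rooted tree, given by its parent map: the root is its own parent (by convention),
and every vertex reaches the root by following parents. The edges of the tree are the pairs
`{v, parent v}` with `v` a vertex other than the root. -/
structure Tree where
  V : Type u
  finite : Finite V
  root : V
  parent : V → V
  parent_root : parent root = root
  reaches : ∀ v, ∃ n : ℕ, parent^[n] v = root

namespace Tree

/-- The edge set of the tree. -/
def edges (T : Tree.{u}) : Set (Sym2 T.V) :=
  {ε | ∃ v, v ≠ T.root ∧ ε = s(v, T.parent v)}

/-- The edges of the union of the paths from the root to all vertices in `S`. -/
def rootPathEdges (T : Tree.{u}) (S : Set T.V) : Set (Sym2 T.V) :=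
  {ε | ∃ v ∈ S, ∃ n : ℕ, T.parent^[n] v ≠ T.root ∧
    ε = s(T.parent^[n] v, T.parent (T.parent^[n] v))}

/-- The length of the path from the root to `v`. -/
noncomputable def level (T : Tree.{u}) (v : T.V) : ℕ := sInf {n | T.parent^[n] v = T.root}

/-- The depth of a rooted tree: the length of a longest path starting at the root. -/
noncomputable def depth (T : Tree.{u}) : ℕ := ⨆ v : T.V, T.level v

/-- The one-vertex tree. -/
def single : Tree.{u} where
  V := PUnit
  finite := inferInstance
  root := PUnit.unit
  parent := id
  parent_root := rfl
  reaches _ := ⟨0, rfl⟩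

open Classical in
/-- Add a new vertex `none`, joined to the old root, and make it the root. -/
noncomputable def addRoot (T : Tree.{u}) : Tree.{u} where
  V := Option T.V
  finite := haveI := T.finite; inferInstance
  root := none
  parent o := o.elim none fun v => if v = T.root then none else some (T.parent v)
  parent_root := rfl
  reaches o := by
    rcases o with _ | v
    · exact ⟨0, rfl⟩
    obtain ⟨n, hn⟩ := T.reaches v
    induction n generalizing v with
    | zero => exact ⟨1, by simpa using hn⟩
    | succ n ih =>
      by_cases hv : v = T.root
      · exact ⟨1, by simpa using hv⟩
      · obtain ⟨m, hm⟩ := ih (T.parent v) hn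
        exact ⟨m + 1, by simpa [hv] using hm⟩

open Classical in
/-- The vertex of the glued tree (see `glue`) that comes from the vertex `v` of the `i`-th tree;
`none` is the common root. -/
noncomputable def glueIn {ι : Type u} (T : ι → Tree.{u}) (i : ι) (v : (T i).V) :
    Option (Σ i, {v : (T i).V // v ≠ (T i).root}) :=
  if h : v = (T i).root then none else some ⟨i, v, h⟩

/-- The tree obtained from disjoint copies of the trees `T i` by identifying all their roots
(the one-vertex tree if there are no trees). -/
noncomputable def glue {ι : Type u} [Finite ι] (T : ι → Tree.{u}) : Tree.{u} where
  V := Option (Σ i, {v : (T i).V // v ≠ (T i).root})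
  finite := haveI := fun i => (T i).finite; inferInstance
  root := none
  parent o := o.elim none fun p => glueIn T p.1 ((T p.1).parent p.2.1)
  parent_root := rfl
  reaches o := by
    rcases o with _ | ⟨i, v, hv⟩
    · exact ⟨0, rfl⟩
    obtain ⟨n, hn⟩ := (T i).reaches v
    induction n generalizing v with
    | zero => exact absurd hn hv
    | succ n ih =>
      by_cases hp : (T i).parent v = (T i).root
      · exact ⟨1, by simp [glueIn, hp]⟩
      · obtain ⟨m, hm⟩ := ih ((T i).parent v) hp hn
        exact ⟨m + 1, by simpa [glueIn, hp] using hm⟩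

end Tree

variable {α : Type u}

/-- `(T, f)` is a depth-decomposition of `M`; only the values of `f` on the ground set matter. -/
def IsDepthDecomposition (M : Matroid α) (T : Tree.{u}) (f : α → T.V) : Prop :=
  M.eRank = T.edges.encard ∧
    ∀ X ⊆ M.E, M.eRk X ≤ (T.rootPathEdges (f '' X)).encard

/-- The branch-depth of a (finite) matroid. -/
noncomputable def bd (M : Matroid α) : ℕ :=
  sInf {d | ∃ (T : Tree.{u}) (f : α → T.V), IsDepthDecomposition M T f ∧ T.depth = d}

/-- A matroid is connected if only the empty set and the whole ground set `E` satisfy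
`r(F) + r(E \ F) = r(E)`. -/
def IsConnected (M : Matroid α) : Prop :=
  ∀ F ⊆ M.E, M.eRk F + M.eRk (M.E \ F) = M.eRank → F = ∅ ∨ F = M.E

/-- A component is an inclusion-wise maximal (nonempty) set `F` such that `M|F` is connected. -/
def IsComponent (M : Matroid α) (F : Set α) : Prop :=
  Maximal (fun F => F ⊆ M.E ∧ F.Nonempty ∧ IsConnected (M.restrict F)) F

/-- The type of components of a matroid. -/
abbrev Component (M : Matroid α) : Type u := {F : Set α // IsComponent M F}

/-- The inputs of the routine: a connected matroid, a circuit and a non-loop element of it.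
For a matroid with a single element, which may have no circuit or no non-loop element,
the parameters `C` and `e` are irrelevant and arbitrary. -/
def IsInput (M : Matroid α) (C : Set α) (e : α) : Prop :=
  IsConnected M ∧ ((M.IsCircuit C ∧ e ∈ C ∧ M.IsNonloop e) ∨ M.E.encard = 1)

/-- The routine called with `(M, C, e)` reaches Step 2 and may choose `C'` there. -/
def Step2 (M : Matroid α) (C : Set α) (e : α) (C' : Set α) : Prop :=
  2 ≤ M.eRank ∧ C.encard = 2 ∧ M.IsCircuit C' ∧ 3 ≤ C'.encard ∧ e ∈ C'

/-- The routine called with `(M, C, e)` reaches Step 3 and may choose `e₁` there. -/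
def Step3 (M : Matroid α) (C : Set α) (e e₁ : α) : Prop :=
  2 ≤ M.eRank ∧ C.encard ≠ 2 ∧ IsConnected (M.contract {e}) ∧ e₁ ∈ C \ {e}

/-- The routine called with `(M, C, e)` reaches Steps 4 and 5. -/
def Step45 (M : Matroid α) (C : Set α) (e : α) : Prop :=
  2 ≤ M.eRank ∧ C.encard ≠ 2 ∧ ¬ IsConnected (M.contract {e})

/-- `D` and `g` are possible choices, in Steps 4 and 5 of the routine called with `(M, C, e)`,
of the circuit and the element passed to the recursive call for the component `F` of `M / e`:
either `F` contains `C \ {e}` (Step 4) or `F` is disjoint from `C` (Step 5). -/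
def Choice45 (M : Matroid α) (C : Set α) (e : α) (F : Set α) (D : Set α) (g : α) : Prop :=
  (C \ {e} ⊆ F ∧ D = C \ {e} ∧ g ∈ D) ∨
    (Disjoint F C ∧ ∃ C', M.IsCircuit C' ∧ C' ⊆ insert e F ∧ e ∈ C' ∧ D = C' \ {e} ∧ g ∈ D)

/-- `Construct M C e T f`: the routine, called with `(M, C, e)`, can return `(T, f)`, the
arbitrary choices of the routine being made in some way. -/
inductive Construct : Matroid α → Set α → α → (T : Tree.{u}) → (α → T.V) → Prop
  | step0 (M : Matroid α) (C : Set α) (e : α) (f : α → Tree.single.V)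
      (hr : M.eRank = 0)
      (hf : ∀ x ∈ M.E, f x = Tree.single.root) :
      Construct M C e Tree.single f
  | step1 (M : Matroid α) (C : Set α) (e : α) (f : α → Tree.single.addRoot.V)
      (hr : M.eRank = 1)
      (hf : ∀ x ∈ M.E, f x = some Tree.single.root) :
      Construct M C e Tree.single.addRoot f
  | step2 (M : Matroid α) (C : Set α) (e : α) (C' : Set α) (T : Tree.{u}) (f : α → T.V)
      (hs : Step2 M C e C')
      (hc : Construct M C' e T f) :
      Construct M C e T f
  | step3 (M : Matroid α) (C : Set α) (e e₁ : α) (T' : Tree.{u}) (f' : α → T'.V)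
      (f : α → T'.addRoot.V)
      (hs : Step3 M C e e₁)
      (hc : Construct (M.contract {e}) (C \ {e}) e₁ T' f')
      (hfe : f e = some T'.root)
      (hf : ∀ x ∈ M.E \ {e}, f x = some (f' x)) :
      Construct M C e T'.addRoot f
  | step45 (M : Matroid α) (C : Set α) (e : α) [Finite (Component (M.contract {e}))]
      (D : Component (M.contract {e}) → Set α) (g : Component (M.contract {e}) → α)
      (T : Component (M.contract {e}) → Tree.{u}) (h : ∀ F, α → (T F).V)
      (f : α → (Tree.glue T).addRoot.V)
      (hs : Step45 M C e)
      (hD : ∀ F, Choice45 M C e F.1 (D F) (g F))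
      (hc : ∀ F, Construct ((M.contract {e}).restrict F.1) (D F) (g F) (T F) (h F))
      (hfe : f e = some (Tree.glue T).root)
      (hf : ∀ F, ∀ x ∈ F.1, f x = some (Tree.glueIn T F (h F x))) :
      Construct M C e (Tree.glue T).addRoot f

/-- `Calls s s'`: the routine called with the parameters `s` can, depending on its choices, call
itself recursively with the parameters `s'`. -/
inductive Calls : Matroid α × Set α × α → Matroid α × Set α × α → Prop
  | step2 (M : Matroid α) (C : Set α) (e : α) (C' : Set α) (hs : Step2 M C e C') :
      Calls (M, C, e) (M, C', e)
  | step3 (M : Matroid α) (C : Set α) (e e₁ : α) (hs : Step3 M C e e₁) :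
      Calls (M, C, e) (M.contract {e}, C \ {e}, e₁)
  | step45 (M : Matroid α) (C : Set α) (e : α) (F : Component (M.contract {e}))
      (D : Set α) (g : α) (hs : Step45 M C e) (hD : Choice45 M C e F.1 D g) :
      Calls (M, C, e) ((M.contract {e}).restrict F.1, D, g)

/-- Whatever choices are made, the routine called with `(M, C, e)` runs to completion: no chain of
recursive calls is infinite, and no call made during the execution gets stuck. -/
def AlwaysReturns (M : Matroid α) (C : Set α) (e : α) : Prop :=
  Acc (fun s' s => Calls s s') (M, C, e) ∧
    ∀ s, Relation.ReflTransGen Calls (M, C, e) s →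
      ∃ (T : Tree.{u}) (f : α → T.V), Construct s.1 s.2.1 s.2.2 T f

/-- `ConstructAll M T f`: the algorithm for an arbitrary matroid `M` can return `(T, f)`. It runs
the routine on each component of `M`, with some circuit and some non-loop element of it, and
identifies the roots of the resulting decompositions. -/
inductive ConstructAll : Matroid α → (T : Tree.{u}) → (α → T.V) → Prop
  | mk (M : Matroid α) [Finite (Component M)] (C : Component M → Set α) (e : Component M → α)
      (T : Component M → Tree.{u}) (h : ∀ F, α → (T F).V) (f : α → (Tree.glue T).V)
      (hi : ∀ F, IsInput (M.restrict F.1) (C F) (e F))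
      (hc : ∀ F, Construct (M.restrict F.1) (C F) (e F) (T F) (h F))
      (hf : ∀ F, ∀ x ∈ F.1, f x = Tree.glueIn T F (h F x)) :
      ConstructAll M (Tree.glue T) f

end BranchDepth

/-!
Contracting `e` turns the circuit `C` into the circuit `C \ {e}`, so as long as the routine does not
switch to another circuit the depth is less than `|C|`. An excess is paid for by an ear of `C`, an
independent set `Q` that is a circuit of `M / C`: if every circuit has at most `n` elements, the
excess is at most `n - 2` for each element of `Q`. As an ear extends to a circuit, the depth is at
most `n ^ 2`.

We can take `n = 2 ^ bd M`. The sets of elements mapped below the vertices of a depth-decomposition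
form a laminar family. Once representatives for a base outside `C` have been removed from it, the
circuit `C` is a minimal set violating Hall's condition. Then some vertex lies above all of `C`, and
after its removal `C` is the union of two minimal violating sets, so each level of the tree at most
doubles `|C|`.
-/

namespace BranchDepth

section Laminar

open Finset

variable {ι β : Type*} {N : β → Finset ι} {C D₁ D₂ Y : Finset β}

/-- A family of sets is laminar if any two of its members that share an element are nested. The
family is given by the finite set `N x` of the indices of its members that contain `x`. -/
def IsLaminar (N : β → Finset ι) : Prop :=
  ∀ ⦃x a b⦄, a ∈ N x → b ∈ N x → {y | a ∈ N y} ⊆ {y | b ∈ N y} ∨ {y | b ∈ N y} ⊆ {y | a ∈ N y}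

lemma IsLaminar.exists_innermost (hN : IsLaminar N) {x : β} (hx : (N x).Nonempty) :
    ∃ a ∈ N x, ∀ b ∈ N x, ∀ y, a ∈ N y → b ∈ N y := by
  obtain ⟨a, ha, hmin⟩ := (N x).finite_toSet.exists_minimalFor (fun a => {y | a ∈ N y}) _ hx
  exact ⟨a, ha, fun b hb => (hN ha hb).elim id fun h => hmin hb h⟩

lemma IsLaminar.exists_outermost (hN : IsLaminar N) {x : β} (hx : (N x).Nonempty) :
    ∃ a ∈ N x, ∀ b ∈ N x, ∀ y, b ∈ N y → a ∈ N y := by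
  obtain ⟨a, ha, hmax⟩ := (N x).finite_toSet.exists_maximalFor (fun a => {y | a ∈ N y}) _ hx
  exact ⟨a, ha, fun b hb => (hN ha hb).elim (fun h => hmax hb h) id⟩

variable [DecidableEq ι]

/-- Fewer than `#X` members of the family `N` meet the set `X`: Hall's condition for systems of
distinct representatives fails at `X`. -/
def IsDeficient (N : β → Finset ι) (X : Finset β) : Prop := #(X.biUnion N) < #X

lemma IsDeficient.nonempty (h : IsDeficient N C) : C.Nonempty :=
  card_pos.1 (Nat.zero_lt_of_lt h)

lemma IsLaminar.sdiff (hN : IsLaminar N) (R : Finset ι) : IsLaminar fun x => N x \ R := by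
  intro x a b ha hb
  simp only [mem_sdiff] at ha hb ⊢
  exact (hN ha.1 hb.1).imp (fun h y hy => ⟨h hy.1, hb.2⟩) fun h y hy => ⟨h hy.1, ha.2⟩

lemma biUnion_sdiff_const (X : Finset β) (N : β → Finset ι) (R : Finset ι) :
    (X.biUnion fun x => N x \ R) = X.biUnion N \ R := by
  ext a
  simp only [mem_biUnion, mem_sdiff]
  tauto

/-- The representatives of the elements of `Y` are chosen greedily: an innermost member around `y`
is the right one, as a set meeting it meets every other member around `y` as well. -/
lemma IsLaminar.exists_representatives [DecidableEq β] (hN : IsLaminar N) {𝓧 : Set (Finset β)}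
    (h𝓧 : ∅ ∈ 𝓧) (hY : ∀ X ∈ 𝓧, ∀ Z ⊆ Y, #X + #Z ≤ #((X ∪ Z).biUnion N)) :
    ∃ R ⊆ Y.biUnion N, #R = #Y ∧ ∀ X ∈ 𝓧, #X ≤ #(X.biUnion N \ R) := by
  induction Y using Finset.induction_on generalizing N with
  | empty => exact ⟨∅, by simp, rfl, fun X hX => by simpa using hY X hX ∅ subset_rfl⟩
  | insert y Y hy ih =>
    have hNy : (N y).Nonempty := by
      simpa [Nat.succ_le_iff, card_pos] using hY ∅ h𝓧 {y} (by simp)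
    obtain ⟨a, hay, ha⟩ := hN.exists_innermost hNy
    obtain ⟨R, hRY, hR, hX⟩ := ih (hN.sdiff {a}) fun X hX Z hZ => by
      rw [biUnion_sdiff_const]
      by_cases haXZ : a ∈ (X ∪ Z).biUnion N
      · obtain ⟨z, hz, haz⟩ := mem_biUnion.1 haXZ
        have hyz : N y ⊆ (X ∪ Z).biUnion N := fun b hb => mem_biUnion.2 ⟨z, hz, ha b hb z haz⟩
        have hXZ := hY X hX (insert y Z) (insert_subset_insert y hZ)
        rw [union_insert, biUnion_insert, union_eq_right.2 hyz,
          card_insert_of_notMem fun h => hy (hZ h)] at hXZ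
        rw [sdiff_singleton_eq_erase, card_erase_of_mem haXZ]
        omega
      · rw [sdiff_singleton_eq_erase, erase_eq_of_notMem haXZ]
        exact hY X hX Z (hZ.trans (subset_insert y Y))
    rw [biUnion_sdiff_const] at hRY
    have haR : a ∉ R := fun h => by simpa using hRY h
    refine ⟨insert a R, ?_, by rw [card_insert_of_notMem haR, card_insert_of_notMem hy, hR],
      fun X hX' => ?_⟩
    · rw [biUnion_insert]
      exact insert_subset (mem_union_left _ hay) (hRY.trans (sdiff_subset.trans subset_union_right))
    · simpa only [biUnion_sdiff_const, sdiff_sdiff_left, sup_eq_union, ← insert_eq] using hX X hX'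

lemma IsLaminar.exists_forall_mem_of_minimal_isDeficient (hN : IsLaminar N)
    (hC : Minimal (IsDeficient N) C) (hC' : 2 ≤ #C) : ∃ a, ∀ x ∈ C, a ∈ N x := by
  classical
  have hsub {X} (hX : X ⊂ C) : #X ≤ #(X.biUnion N) := not_lt.1 (hC.not_prop_of_lt hX)
  obtain ⟨x, hx⟩ : C.Nonempty := card_pos.1 (by omega)
  have hxC : {x} ⊂ C := (ssubset_iff_subset_ne).2 ⟨by simpa, by rintro rfl; simp at hC'⟩
  obtain ⟨a, hax, ha⟩ := hN.exists_outermost (x := x) <| card_pos.1 <| by simpa using hsub hxC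
  refine ⟨a, by_contra fun hCa => ?_⟩
  push Not at hCa
  obtain ⟨w, hwC, hwa⟩ := hCa
  set S := {z ∈ C | a ∈ N z}
  have hSC : S ⊆ C := filter_subset _ _
  have hxS : x ∈ S := mem_filter.2 ⟨hx, hax⟩
  have hS : #S ≤ #(S.biUnion N) := hsub <| (ssubset_iff_of_subset hSC).2 ⟨w, hwC, by simp [S, hwa]⟩
  have hCS : #(C \ S) ≤ #((C \ S).biUnion N) := hsub (sdiff_ssubset hSC ⟨x, hxS⟩)
  have hdisj : Disjoint (S.biUnion N) ((C \ S).biUnion N) := by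
    rw [disjoint_left]
    intro b hb hb'
    obtain ⟨p, hp, hbp⟩ := mem_biUnion.1 hb
    obtain ⟨q, hq, hbq⟩ := mem_biUnion.1 hb'
    have haq : a ∉ N q := fun h => (mem_sdiff.1 hq).2 (mem_filter.2 ⟨(mem_sdiff.1 hq).1, h⟩)
    rcases hN (mem_filter.1 hp).2 hbp with h | h
    · exact haq (ha b (h hax) q hbq)
    · exact haq (h hbq)
  have hunion : S.biUnion N ∪ (C \ S).biUnion N = C.biUnion N := by
    rw [← union_biUnion, union_sdiff_of_subset hSC]
  have hlt := hC.prop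
  rw [IsDeficient, ← hunion, card_union_of_disjoint hdisj,
    ← card_sdiff_add_card_eq_card hSC] at hlt
  omega

lemma IsDeficient.erase_sdiff [DecidableEq β] (hC : IsDeficient N C) (hC' : 2 ≤ #C) {a : ι}
    (ha : ∀ x ∈ C, a ∈ N x) {y : β} (hy : y ∈ C) :
    IsDeficient (fun x => N x \ {a}) (C.erase y) := by
  obtain ⟨z, hz⟩ : (C.erase y).Nonempty := card_pos.1 (by rw [card_erase_of_mem hy]; omega)
  have haz : a ∈ (C.erase y).biUnion N := mem_biUnion.2 ⟨z, hz, ha z (mem_of_mem_erase hz)⟩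
  have hle : #((C.erase y).biUnion N) ≤ #(C.biUnion N) :=
    card_le_card (biUnion_subset_biUnion_of_subset_left N (erase_subset y C))
  unfold IsDeficient at hC ⊢
  rw [biUnion_sdiff_const, sdiff_singleton_eq_erase, card_erase_of_mem haz, card_erase_of_mem hy]
  have := card_pos.2 ⟨a, haz⟩
  omega

lemma IsDeficient.inter_of_sdiff [DecidableEq β] (hC : Minimal (IsDeficient N) C) {a : ι}
    (h₁ : IsDeficient (fun x => N x \ {a}) D₁) (h₂ : IsDeficient (fun x => N x \ {a}) D₂)
    (h : D₁ ∪ D₂ ⊂ C) : IsDeficient (fun x => N x \ {a}) (D₁ ∩ D₂) := by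
  set N' := fun x => N x \ {a} with hN'
  have hinter : #((D₁ ∩ D₂).biUnion N') ≤ #(D₁.biUnion N' ∩ D₂.biUnion N') :=
    card_le_card <| subset_inter (biUnion_subset_biUnion_of_subset_left _ inter_subset_left)
      (biUnion_subset_biUnion_of_subset_left _ inter_subset_right)
  have hunion : #(D₁ ∪ D₂) ≤ #(D₁.biUnion N' ∪ D₂.biUnion N') + 1 := by
    have hle : #(D₁ ∪ D₂) ≤ #((D₁ ∪ D₂).biUnion N) := not_lt.1 (hC.not_prop_of_lt h)
    rw [← union_biUnion, hN', biUnion_sdiff_const, sdiff_singleton_eq_erase]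
    exact hle.trans (Nat.sub_le_iff_le_add.1 pred_card_le_card_erase)
  have := card_union_add_card_inter D₁ D₂
  have := card_union_add_card_inter (D₁.biUnion N') (D₂.biUnion N')
  unfold IsDeficient at h₁ h₂ ⊢
  omega

/-- Once a member containing all of `C` is removed, every `C \ {x}` is deficient, and by uncrossing
two minimal deficient subsets of `C` cover `C`. -/
theorem IsLaminar.card_le_two_pow (hN : IsLaminar N) (hC : Minimal (IsDeficient N) C) {d : ℕ}
    (hd : ∀ x ∈ C, #(N x) ≤ d) : #C ≤ 2 ^ d := by
  classical
  induction d generalizing N C with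
  | zero =>
    by_contra! hC'
    obtain ⟨a, ha⟩ := hN.exists_forall_mem_of_minimal_isDeficient hC hC'
    obtain ⟨x, hx⟩ := hC.prop.nonempty
    exact absurd (hd x hx) (not_le.2 (card_pos.2 ⟨a, ha x hx⟩))
  | succ d ih =>
    rcases lt_or_ge #C 2 with hC' | hC'
    · exact (Nat.le_of_lt_succ hC').trans Nat.one_le_two_pow
    obtain ⟨a, ha⟩ := hN.exists_forall_mem_of_minimal_isDeficient hC hC'
    set N' := fun x => N x \ {a}
    have hcard {D} (hDC : D ⊆ C) (hD : Minimal (IsDeficient N') D) : #D ≤ 2 ^ d := by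
      refine ih (hN.sdiff {a}) hD fun x hx => ?_
      rw [sdiff_singleton_eq_erase, card_erase_of_mem (ha x (hDC hx))]
      exact Nat.sub_le_of_le_add (hd x (hDC hx))
    have hexists {y} (hy : y ∈ C) : ∃ D ⊆ C.erase y, Minimal (IsDeficient N') D :=
      exists_minimal_le_of_wellFoundedLT _ _ (hC.prop.erase_sdiff hC' ha hy)
    obtain ⟨x, hx⟩ := hC.prop.nonempty
    obtain ⟨D₁, hD₁, hmin₁⟩ := hexists hx
    obtain ⟨y, hy⟩ := hmin₁.prop.nonempty
    obtain ⟨D₂, hD₂, hmin₂⟩ := hexists (mem_of_mem_erase (hD₁ hy))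
    have hsub₁ := hD₁.trans (erase_subset x C)
    have hsub₂ := hD₂.trans (erase_subset y C)
    have hcover : D₁ ∪ D₂ = C := by
      refine (union_subset hsub₁ hsub₂).eq_or_ssubset.resolve_right fun h => ?_
      have hinter := IsDeficient.inter_of_sdiff hC hmin₁.prop hmin₂.prop h
      have hle : D₁ ≤ D₁ ∩ D₂ := hmin₁.le_of_le hinter inter_subset_left
      exact notMem_erase y C (hD₂ (mem_inter.1 (hle hy)).2)
    calc #C ≤ #D₁ + #D₂ := hcover ▸ card_union_le D₁ D₂
      _ ≤ 2 ^ d + 2 ^ d := add_le_add (hcard hsub₁ hmin₁) (hcard hsub₂ hmin₂)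
      _ = 2 ^ (d + 1) := by rw [pow_succ, mul_two]

end Laminar

namespace Tree

attribute [instance] Tree.finite

/-- The non-root vertices on the paths from the root to the vertices in `S`. -/
def ancestors (T : Tree.{u}) (S : Set T.V) : Set T.V :=
  {w | w ≠ T.root ∧ ∃ v ∈ S, ∃ n : ℕ, T.parent^[n] v = w}

/-- The number of edges of a tree, counted as its number of non-root vertices. -/
noncomputable def size (T : Tree.{u}) : ℕ := Nat.card {v : T.V // v ≠ T.root}

variable (T : Tree.{u})

lemma iterate_parent_root (n : ℕ) : T.parent^[n] T.root = T.root :=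
  Function.iterate_fixed T.parent_root n

lemma injOn_edge : Set.InjOn (fun v => s(v, T.parent v)) {v : T.V | v ≠ T.root} := by
  intro v hv w _ h
  rcases Sym2.eq_iff.1 h with h | ⟨h₁, h₂⟩
  · exact h.1
  · -- Otherwise `v` and `w` form a cycle of length two, which never reaches the root.
    have hcycle : T.parent^[2] v = v := by simp [h₂, ← h₁]
    obtain ⟨n, hn⟩ := T.reaches v
    have hstay : T.parent^[2 * n] v = v := by
      rw [Function.iterate_mul, Function.iterate_fixed hcycle]
    have hroot : T.parent^[2 * n] v = T.root := by
      rw [two_mul, Function.iterate_add_apply, hn, iterate_parent_root]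
    exact absurd (hstay.symm.trans hroot) hv

lemma encard_edges : T.edges.encard = T.size := by
  have himage : T.edges = (fun v => s(v, T.parent v)) '' {v : T.V | v ≠ T.root} := by
    ext ε
    simp only [edges, Set.mem_ofPred_eq, Set.mem_image, eq_comm]
  rw [himage, T.injOn_edge.encard_image, ← (Set.toFinite _).cast_ncard_eq]
  rfl

lemma encard_rootPathEdges (S : Set T.V) :
    (T.rootPathEdges S).encard = (T.ancestors S).ncard := by
  have himage : T.rootPathEdges S = (fun v => s(v, T.parent v)) '' T.ancestors S := by
    ext ε
    simp only [rootPathEdges, ancestors, Set.mem_ofPred_eq, Set.mem_image]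
    constructor
    · rintro ⟨v, hv, n, hn, rfl⟩
      exact ⟨_, ⟨hn, v, hv, n, rfl⟩, rfl⟩
    · rintro ⟨w, ⟨hw, v, hv, n, rfl⟩, rfl⟩
      exact ⟨v, hv, n, hw, rfl⟩
  rw [himage, (T.injOn_edge.mono fun v hv => hv.1).encard_image,
    (Set.toFinite _).cast_ncard_eq]

lemma size_add_one : T.size + 1 = Nat.card T.V := by
  have hcompl : {v : T.V | v ≠ T.root}ᶜ = {T.root} := by ext; simp
  rw [← Set.ncard_add_ncard_compl {v : T.V | v ≠ T.root}, hcompl, Set.ncard_singleton]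
  rfl

lemma size_single : single.{u}.size = 0 := by
  have hsize := single.{u}.size_add_one
  have hcard : Nat.card single.{u}.V = 1 := Nat.card_unique (α := PUnit)
  omega

lemma size_addRoot : T.addRoot.size = T.size + 1 := by
  have hcard : Nat.card T.addRoot.V = Nat.card T.V + 1 := Finite.card_option (α := T.V)
  have hsize := T.size_add_one
  have hsize' := T.addRoot.size_add_one
  omega

lemma size_glue {ι : Type u} [Fintype ι] (T : ι → Tree.{u}) :
    (glue T).size = ∑ i, (T i).size := by
  have hcard : Nat.card (glue T).V = Nat.card (Σ i, {v : (T i).V // v ≠ (T i).root}) + 1 :=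
    Finite.card_option
  rw [Nat.card_sigma, ← (glue T).size_add_one] at hcard
  exact Nat.add_right_cancel hcard

lemma addRoot_parent_some {v : T.V} (hv : v ≠ T.root) :
    T.addRoot.parent (some v) = some (T.parent v) := if_neg hv

lemma addRoot_parent_some_root : T.addRoot.parent (some T.root) = T.addRoot.root := if_pos rfl

lemma addRoot_iterate_of_iterate {v w : T.V} {n : ℕ} (h : T.parent^[n] v = w) :
    ∃ m, T.addRoot.parent^[m] (some v) = some w := by
  induction n generalizing v with
  | zero => exact ⟨0, congrArg some h⟩
  | succ n ih =>
    by_cases hv : v = T.root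
    · rw [hv, iterate_parent_root] at h
      exact ⟨0, congrArg some (hv.trans h)⟩
    · obtain ⟨m, hm⟩ := ih (v := T.parent v) h
      exact ⟨m + 1, (congrArg T.addRoot.parent^[m] (T.addRoot_parent_some hv)).trans hm⟩

lemma addRoot_iterate_eq_root {v : T.V} {n : ℕ} (h : T.parent^[n] v = T.root) :
    T.addRoot.parent^[n + 1] (some v) = T.addRoot.root := by
  induction n generalizing v with
  | zero =>
    have hv : v = T.root := h
    subst hv
    exact T.addRoot_parent_some_root
  | succ n ih =>
    by_cases hv : v = T.root
    · subst hv
      exact (congrArg T.addRoot.parent^[n + 1] T.addRoot_parent_some_root).trans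
        (T.addRoot.iterate_parent_root _)
    · exact (congrArg T.addRoot.parent^[n + 1] (T.addRoot_parent_some hv)).trans (ih h)

lemma glueIn_root {ι : Type u} (T : ι → Tree.{u}) (i : ι) : glueIn T i (T i).root = none := by
  simp [glueIn]

lemma glueIn_of_ne {ι : Type u} (T : ι → Tree.{u}) (i : ι) {v : (T i).V} (h : v ≠ (T i).root) :
    glueIn T i v = some ⟨i, v, h⟩ := by
  simp [glueIn, h]

lemma glue_iterate_glueIn {ι : Type u} [Finite ι] (T : ι → Tree.{u}) (i : ι) (v : (T i).V) (n : ℕ) :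
    (glue T).parent^[n] (glueIn T i v) = glueIn T i ((T i).parent^[n] v) := by
  induction n generalizing v with
  | zero => rfl
  | succ n ih =>
    refine Eq.trans (congrArg (glue T).parent^[n] ?_) (ih ((T i).parent v))
    by_cases hv : v = (T i).root
    · rw [hv, (T i).parent_root, glueIn_root]; rfl
    · rw [glueIn_of_ne T i hv]; rfl

lemma iterate_level (v : T.V) : T.parent^[T.level v] v = T.root :=
  Nat.sInf_mem (s := {n | T.parent^[n] v = T.root}) (T.reaches v)

lemma level_le_of_iterate {v : T.V} {n : ℕ} (h : T.parent^[n] v = T.root) : T.level v ≤ n :=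
  Nat.sInf_le h

lemma level_le_depth (v : T.V) : T.level v ≤ T.depth :=
  le_ciSup (f := T.level) (Set.finite_range _).bddAbove v

lemma depth_le {d : ℕ} (h : ∀ v, T.level v ≤ d) : T.depth ≤ d := ciSup_le' h

lemma depth_single : single.{u}.depth = 0 :=
  Nat.le_zero.1 <| depth_le _ fun _ => level_le_of_iterate _ (n := 0) rfl

lemma depth_addRoot_le : T.addRoot.depth ≤ T.depth + 1 := by
  refine depth_le _ fun o => ?_
  rcases o with _ | v
  · exact (level_le_of_iterate T.addRoot (n := 0) rfl).trans (Nat.zero_le _)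
  · exact (T.addRoot.level_le_of_iterate (T.addRoot_iterate_eq_root (T.iterate_level v))).trans
      (Nat.succ_le_succ (T.level_le_depth v))

lemma depth_glue_le {ι : Type u} [Finite ι] (T : ι → Tree.{u}) {d : ℕ}
    (h : ∀ i, (T i).depth ≤ d) : (glue T).depth ≤ d := by
  refine depth_le _ fun o => ?_
  rcases o with _ | ⟨i, v, hv⟩
  · exact (level_le_of_iterate (glue T) (n := 0) rfl).trans (Nat.zero_le _)
  · refine ((glue T).level_le_of_iterate (n := (T i).level v) ?_).trans
      (((T i).level_le_depth v).trans (h i))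
    rw [← glueIn_of_ne T i hv, glue_iterate_glueIn, iterate_level, glueIn_root]
    rfl

lemma ancestors_mono {S S' : Set T.V} (h : S ⊆ S') : T.ancestors S ⊆ T.ancestors S' :=
  fun _ ⟨hw, v, hv, hn⟩ => ⟨hw, v, h hv, hn⟩

lemma ncard_ancestors_le_size (S : Set T.V) : (T.ancestors S).ncard ≤ T.size :=
  Set.ncard_le_ncard (t := {v | v ≠ T.root}) fun _ hv => hv.1

lemma ncard_ancestors_singleton_le (v : T.V) : (T.ancestors {v}).ncard ≤ T.depth := by
  have hsub : T.ancestors {v} ⊆ (fun n => T.parent^[n] v) '' Set.Iio (T.level v) := by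
    rintro w ⟨hw, _, rfl, n, rfl⟩
    refine ⟨n, Set.mem_Iio.2 (lt_of_not_ge fun hn => hw ?_), rfl⟩
    obtain ⟨k, rfl⟩ := Nat.exists_eq_add_of_le' hn
    rw [Function.iterate_add_apply, iterate_level, iterate_parent_root]
  calc (T.ancestors {v}).ncard
    _ ≤ ((fun n => T.parent^[n] v) '' Set.Iio (T.level v)).ncard := Set.ncard_le_ncard hsub
    _ ≤ (Set.Iio (T.level v)).ncard := Set.ncard_image_le (Set.finite_Iio _)
    _ = T.level v := by rw [← Finset.coe_Iio, Set.ncard_coe_finset, Nat.card_Iio]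
    _ ≤ T.depth := T.level_le_depth v

lemma ancestors_comparable {v a b : T.V} (ha : a ∈ T.ancestors {v}) (hb : b ∈ T.ancestors {v}) :
    (∃ n, T.parent^[n] a = b) ∨ ∃ n, T.parent^[n] b = a := by
  obtain ⟨-, _, rfl, m, rfl⟩ := ha
  obtain ⟨-, _, rfl, n, rfl⟩ := hb
  rcases le_total m n with h | h
  · obtain ⟨k, rfl⟩ := Nat.exists_eq_add_of_le' h
    exact .inl ⟨k, by rw [Function.iterate_add_apply]⟩
  · obtain ⟨k, rfl⟩ := Nat.exists_eq_add_of_le' h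
    exact .inr ⟨k, by rw [Function.iterate_add_apply]⟩

lemma mem_ancestors_singleton_of_iterate {v a b : T.V} (ha : a ∈ T.ancestors {v})
    (hb : b ≠ T.root) {n : ℕ} (hab : T.parent^[n] a = b) : b ∈ T.ancestors {v} := by
  obtain ⟨-, _, rfl, m, rfl⟩ := ha
  exact ⟨hb, _, rfl, n + m, by rw [Function.iterate_add_apply, hab]⟩

/-- The set `T.ancestors {v}` as a finset. -/
noncomputable def ancestorFinset (v : T.V) : Finset T.V := (T.ancestors {v}).toFinite.toFinset

lemma mem_ancestorFinset {v w : T.V} : w ∈ T.ancestorFinset v ↔ w ∈ T.ancestors {v} :=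
  Set.Finite.mem_toFinset _

lemma card_ancestorFinset_le (v : T.V) : (T.ancestorFinset v).card ≤ T.depth := by
  rw [ancestorFinset, ← Set.ncard_eq_toFinset_card]
  exact T.ncard_ancestors_singleton_le v

lemma isLaminar_ancestorFinset {β : Type*} (f : β → T.V) :
    IsLaminar fun x => T.ancestorFinset (f x) := by
  intro x a b ha hb
  simp only [mem_ancestorFinset] at ha hb ⊢
  refine (T.ancestors_comparable ha hb).imp ?_ ?_ <;> rintro ⟨n, hn⟩ y hy
  · exact T.mem_ancestors_singleton_of_iterate hy hb.1 hn
  · exact T.mem_ancestors_singleton_of_iterate hy ha.1 hn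

lemma card_biUnion_ancestorFinset [DecidableEq T.V] {β : Type*} (f : β → T.V) (X : Finset β) :
    (X.biUnion fun x => T.ancestorFinset (f x)).card = (T.ancestors (f '' X)).ncard := by
  rw [← Set.ncard_coe_finset]
  congr 1
  ext w
  simp only [Finset.coe_biUnion, Set.mem_iUnion₂, Finset.mem_coe, mem_ancestorFinset, ancestors,
    Set.mem_ofPred_eq, Set.mem_singleton_iff, Set.exists_mem_image, exists_eq_left]
  tauto

lemma ncard_ancestors_addRoot {S : Set T.V} (hS : S.Nonempty) {S' : Set T.addRoot.V}
    (h : some '' S ⊆ S') : (T.ancestors S).ncard + 1 ≤ (T.addRoot.ancestors S').ncard := by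
  have hroot : T.root ∉ T.ancestors S := fun h => h.1 rfl
  rw [← Set.ncard_insert_of_notMem hroot,
    ← Set.ncard_image_of_injective _ (Option.some_injective _)]
  refine Set.ncard_le_ncard ?_
  rintro _ ⟨w, hw, rfl⟩
  obtain ⟨v, hv, n, hn⟩ : ∃ v ∈ S, ∃ n, T.parent^[n] v = w := by
    rcases hw with rfl | hw
    · exact hS.imp fun v hv => ⟨hv, T.reaches v⟩
    · exact hw.2
  exact ⟨Option.some_ne_none w, some v, h ⟨v, hv, rfl⟩, T.addRoot_iterate_of_iterate hn⟩

lemma sum_ncard_ancestors_le_glue {ι : Type u} [Fintype ι] (T : ι → Tree.{u})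
    (S : ∀ i, Set (T i).V) {S' : Set (glue T).V} (h : ∀ i, glueIn T i '' S i ⊆ S') :
    ∑ i, ((T i).ancestors (S i)).ncard ≤ ((glue T).ancestors S').ncard := by
  have hsum : ∑ i, ((T i).ancestors (S i)).ncard = Nat.card (Σ i, (T i).ancestors (S i)) := by
    rw [Nat.card_sigma]; rfl
  rw [hsum]
  let φ : (Σ i, (T i).ancestors (S i)) → (glue T).ancestors S' := fun p =>
    ⟨some ⟨p.1, p.2.1, p.2.2.1⟩, fun h => Option.some_ne_none _ h, by
      obtain ⟨i, w, hw, v, hv, n, hn⟩ := p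
      refine ⟨glueIn T i v, h i ⟨v, hv, rfl⟩, n, ?_⟩
      rw [glue_iterate_glueIn, hn, glueIn_of_ne T i hw]⟩
  refine Nat.card_le_card_of_injective φ ?_
  rintro ⟨i, w, hw⟩ ⟨j, w', hw'⟩ hφ
  obtain ⟨rfl, hheq⟩ := Sigma.mk.inj (Option.some_injective _ (congrArg Subtype.val hφ))
  obtain rfl : w = w' := congrArg Subtype.val (eq_of_heq hheq)
  rfl

end Tree

open Set Matroid

variable {α : Type u} {M : Matroid α} {X Y F S C C' D K Q R : Set α} {e e₁ g x : α}

/-- The rank of a set as a natural number; it is `0` for sets of infinite rank. -/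
noncomputable def rk (M : Matroid α) (X : Set α) : ℕ := (M.eRk X).toNat

section Rank

lemma rk_empty (M : Matroid α) : rk M ∅ = 0 := by simp [rk]

lemma rk_restrict (h : X ⊆ S) : rk (M ↾ S) X = rk M X := by
  rw [rk, rk, restrict_eRk_eq _ h]

lemma rk_eq_ncard_of_indep (h : M.Indep X) : rk M X = X.ncard := by
  rw [rk, h.eRk_eq_encard, Set.ncard]

variable [M.RankFinite]

lemma coe_rk (M : Matroid α) [M.RankFinite] (X : Set α) : (rk M X : ℕ∞) = M.eRk X :=
  ENat.natCast_toNat (eRk_ne_top_iff.2 (M.isRkFinite_set X))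

lemma eRank_eq_rk (M : Matroid α) [M.RankFinite] : M.eRank = rk M M.E := by
  rw [coe_rk, eRk_ground]

lemma rk_mono (h : X ⊆ Y) : rk M X ≤ rk M Y := by
  rw [← Nat.cast_le (α := ℕ∞), coe_rk, coe_rk]
  exact M.eRk_mono h

lemma rk_inter_add_rk_union_le (M : Matroid α) [M.RankFinite] (X Y : Set α) :
    rk M (X ∩ Y) + rk M (X ∪ Y) ≤ rk M X + rk M Y := by
  rw [← Nat.cast_le (α := ℕ∞)]
  push_cast
  simp only [coe_rk]
  exact M.eRk_inter_add_eRk_union_le X Y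

lemma rk_union_le (M : Matroid α) [M.RankFinite] (X Y : Set α) :
    rk M (X ∪ Y) ≤ rk M X + rk M Y :=
  (Nat.le_add_left _ _).trans (rk_inter_add_rk_union_le M X Y)

lemma mem_closure_of_rk_insert_le (he : e ∈ M.E) (h : rk M (insert e X) ≤ rk M X) :
    e ∈ M.closure X := by
  by_contra hcl
  have hrk := eRk_insert_eq_add_one ⟨he, hcl⟩
  rw [← coe_rk, ← coe_rk] at hrk
  norm_cast at hrk
  omega

lemma rk_add_one_of_isCircuit (h : M.IsCircuit C) : rk M C + 1 = C.ncard := by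
  have hrk := h.eRk_add_one_eq
  rw [← coe_rk, ← h.finite.cast_ncard_eq] at hrk
  exact_mod_cast hrk

lemma indep_of_ncard_le_rk (hX : X.Finite) (h : X.ncard ≤ rk M X) : M.Indep X := by
  rw [indep_iff_eRk_eq_encard_of_finite hX]
  refine (M.eRk_le_encard X).antisymm ?_
  rw [← coe_rk, ← hX.cast_ncard_eq]
  exact_mod_cast h

lemma rk_contract (he : M.IsNonloop e) (hX : X ⊆ M.E \ {e}) :
    rk (M ／ {e}) X + 1 = rk M (insert e X) := by
  obtain ⟨J, hJ⟩ := (M ／ {e}).exists_isBasis X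
  have hbasis := (indep_singleton.2 he).union_isBasis_union_of_contract_isBasis hJ
  have heJ : e ∉ J := fun h => (hX (hJ.subset h)).2 rfl
  have hrk := hbasis.encard_eq_eRk
  rw [union_singleton, union_singleton, encard_insert_of_notMem heJ, hJ.encard_eq_eRk, ← coe_rk,
    ← coe_rk] at hrk
  exact_mod_cast hrk

lemma rk_contract_ground (he : M.IsNonloop e) : rk (M ／ {e}) (M ／ {e}).E + 1 = rk M M.E := by
  rw [contract_ground, rk_contract he subset_rfl, insert_sdiff_singleton,
    insert_eq_of_mem he.mem_ground]

end Rank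

section DepthDecomposition

variable {T : Tree.{u}} {f : α → T.V}

lemma isDepthDecomposition_iff [M.RankFinite] :
    IsDepthDecomposition M T f ↔
      rk M M.E = T.size ∧ ∀ X ⊆ M.E, rk M X ≤ (T.ancestors (f '' X)).ncard := by
  simp only [IsDepthDecomposition, T.encard_edges, T.encard_rootPathEdges, eRank_eq_rk, ← coe_rk,
    Nat.cast_inj, Nat.cast_le]

lemma IsDepthDecomposition.card_le_card_biUnion [M.RankFinite] [DecidableEq T.V]
    (h : IsDepthDecomposition M T f) {X : Finset α} (hX : M.Indep X) :
    X.card ≤ (X.biUnion fun x => T.ancestorFinset (f x)).card := by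
  rw [← ncard_coe_finset, ← rk_eq_ncard_of_indep hX, T.card_biUnion_ancestorFinset]
  exact (isDepthDecomposition_iff.1 h).2 _ hX.subset_ground

/-- A base contains all but one element of `C`; the rest of it is `Y`. Its union with the missing
element contains no circuit other than `C`. -/
lemma exists_forall_ssubset_indep_union_of_isCircuit [M.RankFinite] (hC : M.IsCircuit C) :
    ∃ Y, M.Indep Y ∧ Disjoint C Y ∧ Y.ncard + C.ncard = rk M M.E + 1 ∧
      ∀ X ⊂ C, M.Indep (X ∪ Y) := by
  obtain ⟨e, he⟩ := hC.nonempty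
  obtain ⟨B, hB, hCB⟩ := (hC.sdiff_singleton_indep he).exists_isBase_superset
  have hCins : C ⊆ insert e B := sdiff_singleton_subset_iff.1 hCB
  have heB : e ∉ B := fun h => hC.dep.not_indep (hB.indep.subset (insert_eq_of_mem h ▸ hCins))
  refine ⟨B \ C, hB.indep.subset sdiff_subset, disjoint_sdiff_right, ?_, fun X hX => ?_⟩
  · have hinter : B ∩ C = C \ {e} := by
      exact Subset.antisymm (fun x hx => ⟨hx.2, fun h => heB (h ▸ hx.1)⟩)
        fun x hx => ⟨hCB hx, hx.1⟩
    have hrk : rk M M.E = B.ncard := by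
      rw [rk, eRk_ground, ← hB.encard_eq_eRank, Set.ncard]
    have hB' := ncard_inter_add_ncard_sdiff_eq_ncard B C hB.finite
    have hC' := ncard_sdiff_singleton_add_one he hC.finite
    rw [hinter] at hB'
    omega
  · have hXB : X ∪ B \ C ⊆ insert e B :=
      union_subset (hX.subset.trans hCins) (sdiff_subset.trans (subset_insert e B))
    have hXE : X ∪ B \ C ⊆ M.E :=
      hXB.trans (insert_subset (hC.subset_ground he) hB.subset_ground)
    refine (indep_iff_forall_subset_not_isCircuit hXE).2 fun D hDX hD => hX.not_subset ?_
    obtain rfl : D = C := (hD.eq_fundCircuit_of_subset hB.indep (hDX.trans hXB)).trans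
      (hC.eq_fundCircuit_of_subset hB.indep hCins).symm
    exact fun x hx => (hDX hx).resolve_right fun h => h.2 hx

/-- The sets of elements mapped below the vertices of `T` form a laminar family. Representatives of
the elements of a base outside `C` are removed from it so that `C` becomes minimally deficient. -/
theorem IsDepthDecomposition.ncard_circuit_le [M.RankFinite] (h : IsDepthDecomposition M T f)
    (hC : M.IsCircuit C) : C.ncard ≤ 2 ^ T.depth := by
  classical
  have hrank := (isDepthDecomposition_iff.1 h).1
  obtain ⟨Y, hY, hCY, hcard, hindep⟩ := exists_forall_ssubset_indep_union_of_isCircuit hC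
  lift C to Finset α using hC.finite
  lift Y to Finset α using hY.finite
  simp only [ncard_coe_finset] at hcard ⊢
  have hN := T.isLaminar_ancestorFinset f
  set N := fun x => T.ancestorFinset (f x)
  have hXZ : ∀ X ∈ {X | X ⊂ C}, ∀ Z ⊆ Y, X.card + Z.card ≤ ((X ∪ Z).biUnion N).card := by
    intro X hX Z hZ
    have hdisj : Disjoint X Z := (Finset.disjoint_coe.1 hCY).mono hX.1 hZ
    rw [← Finset.card_union_of_disjoint hdisj]
    refine h.card_le_card_biUnion ?_
    rw [Finset.coe_union]
    exact (hindep X (Finset.coe_ssubset.2 hX)).subset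
      (union_subset_union_right _ (Finset.coe_subset.2 hZ))
  obtain ⟨R, hRY, hR, hRX⟩ := hN.exists_representatives
    (Finset.empty_ssubset.2 (Finset.coe_nonempty.1 hC.nonempty)) hXZ
  have hdeficient : IsDeficient (fun x => N x \ R) C := by
    have hsize : (C.biUnion N ∪ R).card ≤ T.size := by
      refine (Finset.card_le_card (Finset.union_subset_union_right hRY)).trans ?_
      rw [← Finset.union_biUnion, T.card_biUnion_ancestorFinset]
      exact T.ncard_ancestors_le_size _
    rw [← Finset.card_sdiff_add_card] at hsize
    rw [IsDeficient, biUnion_sdiff_const]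
    omega
  have hmin : Minimal (IsDeficient fun x => N x \ R) C :=
    minimal_iff_forall_lt.2 ⟨hdeficient, fun X hX =>
      not_lt.2 ((hRX X hX).trans_eq (by rw [biUnion_sdiff_const]))⟩
  exact (hN.sdiff R).card_le_two_pow hmin fun x _ =>
    (Finset.card_le_card Finset.sdiff_subset).trans (T.card_ancestorFinset_le (f x))

lemma IsDepthDecomposition.ncard_circuit_le_two_pow_bd [M.RankFinite]
    (h : IsDepthDecomposition M T f) (hC : M.IsCircuit C) : C.ncard ≤ 2 ^ bd M := by
  obtain ⟨T', f', h', hd⟩ := Nat.sInf_mem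
    (s := {d | ∃ (T : Tree.{u}) (f : α → T.V), IsDepthDecomposition M T f ∧ T.depth = d})
    ⟨_, T, f, h, rfl⟩
  exact (h'.ncard_circuit_le hC).trans_eq (congrArg (2 ^ ·) hd)

end DepthDecomposition

section Connectivity

/-- A separator of a matroid: a set `F` with `r(F) + r(E \ F) = r(E)`. -/
def IsSeparator (M : Matroid α) (F : Set α) : Prop :=
  F ⊆ M.E ∧ rk M F + rk M (M.E \ F) = rk M M.E

lemma isConnected_iff [M.RankFinite] :
    IsConnected M ↔ ∀ F, IsSeparator M F → F = ∅ ∨ F = M.E := by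
  simp only [IsConnected, IsSeparator, eRank_eq_rk, ← coe_rk, and_imp]
  norm_cast

lemma rk_ground_le (hF : F ⊆ M.E) [M.RankFinite] : rk M M.E ≤ rk M F + rk M (M.E \ F) := by
  conv_lhs => rw [← union_sdiff_cancel hF]
  exact rk_union_le M F (M.E \ F)

lemma isSeparator_of_le [M.RankFinite] (hF : F ⊆ M.E)
    (h : rk M F + rk M (M.E \ F) ≤ rk M M.E) : IsSeparator M F :=
  ⟨hF, h.antisymm (rk_ground_le hF)⟩

lemma isSeparator_singleton_of_isLoop [M.RankFinite] (he : M.IsLoop e) : IsSeparator M {e} := by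
  refine isSeparator_of_le (singleton_subset_iff.2 he.mem_ground) ?_
  have hrk : rk M {e} = 0 := by simp [rk, he.eRk_eq]
  rw [hrk, zero_add]
  exact rk_mono sdiff_subset

lemma IsConnected.rk_lt [M.RankFinite] (h : IsConnected M) (hF : F ⊆ M.E) (hne : F.Nonempty)
    (hne' : (M.E \ F).Nonempty) : rk M M.E < rk M F + rk M (M.E \ F) := by
  refine (rk_ground_le hF).lt_of_ne fun heq => ?_
  rcases isConnected_iff.1 h F ⟨hF, heq.symm⟩ with rfl | rfl
  · exact not_nonempty_empty hne
  · exact not_nonempty_empty (sdiff_self (a := M.E) ▸ hne')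

/-- Submodularity for `X` and `S`, and again for `X ∪ S` and `E \ S`, bounds
`r(X ∩ S) + r(X \ S)` by `r(X)`. -/
lemma IsSeparator.rk_inter_add [M.RankFinite] (h : IsSeparator M S) (hX : X ⊆ M.E) :
    rk M (X ∩ S) + rk M (X \ S) = rk M X := by
  have hinter : (X ∪ S) ∩ (M.E \ S) = X \ S := by
    rw [← inter_sdiff_assoc, inter_eq_left.2 (union_subset hX h.1), union_sdiff_right]
  have hunion : (X ∪ S) ∪ (M.E \ S) = M.E := by
    rw [union_assoc, union_sdiff_cancel h.1, union_eq_right.2 hX]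
  have hXS := rk_inter_add_rk_union_le M X S
  have hXSc := rk_inter_add_rk_union_le M (X ∪ S) (M.E \ S)
  rw [hinter, hunion] at hXSc
  have hle := rk_union_le M (X ∩ S) (X \ S)
  rw [inter_union_sdiff] at hle
  have := h.2
  omega

lemma IsSeparator.compl (h : IsSeparator M S) : IsSeparator M (M.E \ S) := by
  refine ⟨sdiff_subset, ?_⟩
  rw [sdiff_sdiff_cancel_left h.1, add_comm, h.2]

lemma IsSeparator.subset_or_disjoint [M.RankFinite] (h : IsSeparator M S) (hX : X ⊆ M.E)
    (hc : IsConnected (M ↾ X)) : X ⊆ S ∨ Disjoint X S := by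
  rcases isConnected_iff.1 hc (X ∩ S) ⟨inter_subset_left, by
    rw [restrict_ground_eq, rk_restrict inter_subset_left, rk_restrict sdiff_subset,
      rk_restrict subset_rfl, sdiff_self_inter, h.rk_inter_add hX]⟩ with h' | h'
  · exact .inr (disjoint_iff_inter_eq_empty.2 h')
  · exact .inl (inter_eq_left.1 h')

lemma IsSeparator.of_restrict [M.RankFinite] (hS : IsSeparator M S) {R : Set α}
    (hR : IsSeparator (M ↾ S) R) : IsSeparator M R := by
  have hRS : R ⊆ S := hR.1
  have hrk := hR.2
  rw [restrict_ground_eq, rk_restrict hRS, rk_restrict sdiff_subset, rk_restrict subset_rfl] at hrk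
  refine isSeparator_of_le (hRS.trans hS.1) ?_
  have hcompl : M.E \ R = (S \ R) ∪ (M.E \ S) :=
    (sdiff_union_sdiff_cancel hS.1 hRS).symm.trans (union_comm _ _)
  have hle := rk_union_le M (S \ R) (M.E \ S)
  have := hS.2
  rw [hcompl]
  omega

lemma isConnected_restrict_singleton (M : Matroid α) (x : α) : IsConnected (M ↾ {x}) :=
  fun _ hF _ => subset_singleton_iff_eq.1 hF

lemma exists_isComponent_superset [M.Finite] (hX : X ⊆ M.E) (hne : X.Nonempty)
    (hc : IsConnected (M ↾ X)) : ∃ F, IsComponent M F ∧ X ⊆ F := by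
  obtain ⟨F, hXF, hF⟩ := Set.Finite.exists_le_maximal
    (s := {F | F ⊆ M.E ∧ F.Nonempty ∧ IsConnected (M.restrict F)}) (a := X)
    (M.ground_finite.finite_subsets.subset fun F hF => hF.1) ⟨hX, hne, hc⟩
  exact ⟨F, hF, hXF⟩

lemma exists_isComponent_mem [M.Finite] (hx : x ∈ M.E) : ∃ F, IsComponent M F ∧ x ∈ F := by
  obtain ⟨F, hF, h⟩ := exists_isComponent_superset (singleton_subset_iff.2 hx)
    (singleton_nonempty x) (isConnected_restrict_singleton M x)
  exact ⟨F, hF, h rfl⟩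

/-- A minimal separator containing the component `F` restricts to a connected matroid, so it is `F`
by maximality. -/
lemma IsComponent.isSeparator [M.Finite] (hF : IsComponent M F) : IsSeparator M F := by
  obtain ⟨S, ⟨hS, hFS⟩, hmin⟩ : ∃ S, Minimal (fun S => IsSeparator M S ∧ F ⊆ S) S :=
    Finite.exists_minimal (s := {S | IsSeparator M S ∧ F ⊆ S})
      (M.ground_finite.finite_subsets.subset fun S hS => hS.1.1)
      ⟨M.E, ⟨subset_rfl, by simp [rk_empty]⟩, hF.1.1⟩
  have hmin_eq : ∀ R, IsSeparator (M ↾ S) R → F ⊆ R → R = S := fun R hR hFR =>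
    subset_antisymm hR.1 (hmin ⟨hS.of_restrict hR, hFR⟩ hR.1)
  suffices hconn : IsConnected (M ↾ S) by
    rw [hF.eq_of_subset ⟨hS.1, hF.1.2.1.mono hFS, hconn⟩ hFS]
    exact hS
  refine isConnected_iff.2 fun R hR => ?_
  rcases (hS.of_restrict hR).subset_or_disjoint hF.1.1 hF.1.2.2 with h | h
  · exact .inr (hmin_eq R hR h)
  · have hcompl := hmin_eq _ hR.compl (subset_sdiff.2 ⟨hFS, h⟩)
    rw [restrict_ground_eq, sdiff_eq_left] at hcompl
    exact .inl (disjoint_self.1 (hcompl.mono_left hR.1))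

lemma IsComponent.eq_of_not_disjoint [M.Finite] (hF : IsComponent M F) {F' : Set α}
    (hF' : IsComponent M F') (h : ¬ Disjoint F F') : F = F' :=
  hF.eq_of_subset hF'.1 ((hF'.isSeparator.subset_or_disjoint hF.1.1 hF.1.2.2).resolve_right h)

instance (M : Matroid α) [M.Finite] : Finite (Component M) :=
  (M.ground_finite.finite_subsets.subset fun F (hF : IsComponent M F) => hF.1.1).to_subtype

lemma Component.finite_restrict [M.Finite] (F : Component M) : (M ↾ F.1).Finite :=
  restrict_finite (M.set_finite F.1 F.2.1.1)

lemma Component.eq_of_mem [M.Finite] {F F' : Component M} (h : x ∈ F.1) (h' : x ∈ F'.1) :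
    F = F' :=
  Subtype.ext (F.2.eq_of_not_disjoint F'.2 (not_disjoint_iff.2 ⟨x, h, h'⟩))

lemma exists_forall_component_eq [M.Finite] {β : Type*} (φ : Component M → α → β) (b : β) :
    ∃ f : α → β, (∀ F, ∀ x ∈ F.1, f x = φ F x) ∧ ∀ x ∉ M.E, f x = b := by
  classical
  refine ⟨fun x => if h : ∃ F : Component M, x ∈ F.1 then φ h.choose x else b,
    fun F x hx => ?_, fun x hx => dif_neg fun ⟨F, hF⟩ => hx (F.2.1.1 hF)⟩
  have h : ∃ F : Component M, x ∈ F.1 := ⟨F, hx⟩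
  simp only [dif_pos h, Component.eq_of_mem h.choose_spec hx]

lemma iUnion_component [M.Finite] : ⋃ F : Component M, F.1 = M.E := by
  refine subset_antisymm (iUnion_subset fun F => F.2.1.1) fun x hx => ?_
  obtain ⟨F, hF, hxF⟩ := exists_isComponent_mem hx
  exact mem_iUnion.2 ⟨⟨F, hF⟩, hxF⟩

lemma rk_biUnion_le {ι : Type*} [M.RankFinite] (s : Finset ι) (A : ι → Set α) :
    rk M (⋃ i ∈ s, A i) ≤ ∑ i ∈ s, rk M (A i) := by
  classical
  induction s using Finset.induction_on with
  | empty => simp [rk_empty]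
  | insert i s his ih =>
    rw [Finset.set_biUnion_insert, Finset.sum_insert his]
    exact (rk_union_le M _ _).trans (Nat.add_le_add_left ih _)

lemma rk_biUnion_component [M.Finite] (s : Finset (Component M)) :
    rk M (⋃ F ∈ s, F.1) = ∑ F ∈ s, rk M F.1 := by
  classical
  induction s using Finset.induction_on with
  | empty => simp [rk_empty]
  | insert F s hFs ih =>
    have hsub : (⋃ F' ∈ s, F'.1) ⊆ M.E := iUnion₂_subset fun F' _ => F'.2.1.1
    have hdisj : Disjoint (⋃ F' ∈ s, F'.1) F.1 := disjoint_left.2 fun x hx hxF => by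
      obtain ⟨F', hF', hxF'⟩ := mem_iUnion₂.1 hx
      exact hFs (Component.eq_of_mem hxF hxF' ▸ hF')
    rw [Finset.set_biUnion_insert, Finset.sum_insert hFs, ← ih,
      ← F.2.isSeparator.rk_inter_add (union_subset F.2.1.1 hsub), union_inter_cancel_left,
      union_sdiff_left, hdisj.sdiff_eq_left]

lemma rk_ground_eq_sum [M.Finite] [Fintype (Component M)] :
    rk M M.E = ∑ F : Component M, rk M F.1 := by
  rw [← rk_biUnion_component]
  simp only [Finset.mem_univ, iUnion_true, iUnion_component]

lemma rk_le_sum [M.Finite] [Fintype (Component M)] (hX : X ⊆ M.E) :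
    rk M X ≤ ∑ F : Component M, rk M (X ∩ F.1) := by
  refine le_trans (rk_mono ?_) (rk_biUnion_le Finset.univ fun F : Component M => X ∩ F.1)
  simp only [Finset.mem_univ, iUnion_true]
  rw [← inter_iUnion, iUnion_component, inter_eq_left.2 hX]

lemma isConnected_restrict_of_isCircuit [M.RankFinite] (hC : M.IsCircuit C) :
    IsConnected (M ↾ C) := by
  refine isConnected_iff.2 fun F ⟨hF, hsep⟩ => ?_
  rw [restrict_ground_eq] at hF hsep ⊢
  rw [rk_restrict hF, rk_restrict sdiff_subset, rk_restrict subset_rfl] at hsep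
  by_contra! hne
  have hFC : F ⊂ C := hF.ssubset_of_ne hne.2
  have hCF : C \ F ⊂ C := sdiff_ssubset_left_iff.2 (by rw [inter_eq_right.2 hF]; exact hne.1)
  rw [rk_eq_ncard_of_indep (hC.ssubset_indep hFC),
    rk_eq_ncard_of_indep (hC.ssubset_indep hCF)] at hsep
  have hcard := ncard_sdiff_add_ncard_of_subset hF hC.finite
  have hrk := rk_add_one_of_isCircuit hC
  omega

lemma IsComponent.subset_or_disjoint_of_isCircuit [M.Finite] (hF : IsComponent M F)
    (hC : M.IsCircuit C) : C ⊆ F ∨ Disjoint C F :=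
  hF.isSeparator.subset_or_disjoint hC.subset_ground (isConnected_restrict_of_isCircuit hC)

lemma IsConnected.isNonloop [M.RankFinite] (h : IsConnected M) (hr : 1 ≤ M.eRank) (he : e ∈ M.E) :
    M.IsNonloop e := by
  refine isNonloop_of_not_isLoop he fun hloop => ?_
  rcases isConnected_iff.1 h _ (isSeparator_singleton_of_isLoop hloop) with h' | h'
  · exact singleton_ne_empty e h'
  · rw [← eRk_ground, ← h', hloop.eRk_eq] at hr
    exact absurd hr (by simp)

lemma IsConnected.exists_isCircuit_mem [M.RankFinite] (h : IsConnected M) (he : e ∈ M.E)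
    (hne : M.E ≠ {e}) : ∃ C, M.IsCircuit C ∧ e ∈ C := by
  have he' : {e} ⊆ M.E := singleton_subset_iff.2 he
  have hrk := h.rk_lt he' (singleton_nonempty e)
    (nonempty_of_ssubset (he'.ssubset_of_ne hne.symm))
  have hrk_e : rk M {e} ≤ 1 := by
    rw [← Nat.cast_le (α := ℕ∞), coe_rk]
    exact M.eRk_singleton_le e
  have hcl : e ∈ M.closure (M.E \ {e}) := mem_closure_of_rk_insert_le he <| by
    rw [insert_sdiff_singleton, insert_eq_of_mem he]
    omega
  obtain ⟨C, -, hC, heC⟩ := exists_isCircuit_of_mem_closure hcl (by simp)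
  exact ⟨C, hC, heC⟩

lemma nontrivial_of_isCircuit_of_isNonloop (hC : M.IsCircuit C) (he : M.IsNonloop e)
    (heC : e ∈ C) : C.Nontrivial := by
  refine not_subsingleton_iff.1 fun h => ?_
  rw [h.eq_singleton_of_mem heC, singleton_isCircuit] at hC
  exact hC.not_isNonloop he

lemma three_le_encard_of_isCircuit (hC : M.IsCircuit C) (he : M.IsNonloop e) (heC : e ∈ C)
    (hcl : Disjoint (C \ {e}) (M.closure {e})) : 3 ≤ C.encard := by
  obtain ⟨x, hxC, hxe⟩ := (nontrivial_of_isCircuit_of_isNonloop hC he heC).exists_ne e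
  by_contra! hlt
  have hsub : C \ {x} ⊆ {e} := by
    by_contra hsub
    obtain ⟨y, ⟨hyC, hyx⟩, hye⟩ := not_subset.1 hsub
    refine hlt.not_ge ?_
    rw [← encard_eq_three.2 ⟨e, x, y, hxe.symm, Ne.symm hye, Ne.symm hyx, rfl⟩]
    exact encard_le_encard (insert_subset heC (pair_subset hxC hyC))
  exact disjoint_left.1 hcl ⟨hxC, hxe⟩
    (M.closure_subset_closure hsub (hC.mem_closure_sdiff_singleton_of_mem hxC))

/-- The parallel class of `e` is not a separator, so `e` is spanned by the elements not parallel to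
it. -/
lemma IsConnected.exists_isCircuit_three_le [M.RankFinite] (h : IsConnected M) (hr : 2 ≤ M.eRank)
    (he : e ∈ M.E) : ∃ C, M.IsCircuit C ∧ 3 ≤ C.encard ∧ e ∈ C := by
  have hnl := h.isNonloop (one_le_two.trans hr) he
  have hr' : 2 ≤ rk M M.E := by
    rw [eRank_eq_rk] at hr
    exact_mod_cast hr
  have heP : e ∈ M.closure {e} := M.mem_closure_self e
  have hP : rk M (M.closure {e}) = 1 := by rw [rk, eRk_closure_eq, hnl.eRk_eq]; rfl
  have hne : (M.E \ M.closure {e}).Nonempty := sdiff_nonempty.2 fun hsub => by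
    have := rk_mono (M := M) hsub
    omega
  have hlt := h.rk_lt (M.closure_subset_ground _) ⟨e, heP⟩ hne
  have hcl : e ∈ M.closure (M.E \ M.closure {e}) := mem_closure_of_rk_insert_le he <| by
    have := rk_mono (M := M) (insert_subset he (sdiff_subset (s := M.E) (t := M.closure {e})))
    omega
  obtain ⟨C, hCsub, hC, heC⟩ := exists_isCircuit_of_mem_closure hcl (fun h => h.2 heP)
  exact ⟨C, hC, three_le_encard_of_isCircuit hC hnl heC <| disjoint_left.2 fun x hx =>
    ((hCsub hx.1).resolve_left hx.2).2, heC⟩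

lemma IsConnected.exists_isCircuit_of_component [M.Finite] (h : IsConnected M)
    (he : M.IsNonloop e) (hF : IsComponent (M ／ {e}) F) :
    ∃ C, M.IsCircuit C ∧ C ⊆ insert e F ∧ e ∈ C := by
  have hFE : F ⊆ M.E \ {e} := hF.1.1
  have heF : e ∉ F := fun h' => (hFE h').2 rfl
  have heFc : e ∈ M.E \ F := ⟨he.mem_ground, heF⟩
  have hinsert : insert e ((M.E \ {e}) \ F) = M.E \ F := by
    rw [sdiff_sdiff_comm, insert_sdiff_singleton, insert_eq_of_mem heFc]
  have hsep := hF.isSeparator.2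
  have hrkF := rk_contract he hFE
  have hrkFc := rk_contract he (X := (M.E \ {e}) \ F) sdiff_subset
  have hrkE := rk_contract_ground he
  rw [hinsert] at hrkFc
  rw [contract_ground] at hsep hrkE
  have hlt := h.rk_lt (hFE.trans sdiff_subset) hF.1.2.1 ⟨e, heFc⟩
  have hcl : e ∈ M.closure F := mem_closure_of_rk_insert_le he.mem_ground (by omega)
  obtain ⟨C, hCsub, hC, heC⟩ := exists_isCircuit_of_mem_closure hcl heF
  exact ⟨C, hC, hCsub, heC⟩

end Connectivity

section Ears

/-- An ear of a set `C`: an independent set that is a circuit after `C` is contracted. Ears of a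
circuit `C` are what makes longer circuits out of `C`. -/
def IsEar (M : Matroid α) (C Q : Set α) : Prop := (M ／ C).IsCircuit Q ∧ M.Indep Q

lemma IsEar.of_contract_restrict {R : Set α} (hR : R ⊆ M.E \ {e}) (he : e ∈ C)
    (hC : C \ {e} ⊆ R) (h : IsEar ((M ／ {e}) ↾ R) (C \ {e}) Q) :
    IsEar M C Q ∧ (M ／ {e}).Indep Q := by
  obtain ⟨hcirc, hindep⟩ := h
  have hsub : R \ (C \ {e}) ⊆ (M ／ C).E := fun y hy =>
    ⟨(hR hy.1).1, fun hyC => hy.2 ⟨hyC, (hR hy.1).2⟩⟩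
  rw [restrict_contract_eq_contract_restrict _ hC, contract_contract, union_sdiff_self,
    union_eq_self_of_subset_left (singleton_subset_iff.2 he), restrict_isCircuit_iff hsub] at hcirc
  exact ⟨⟨hcirc.1, hindep.of_restrict.of_contract⟩, hindep.of_restrict⟩

lemma IsEar.exists_isCircuit_ssuperset (h : IsEar M C Q) :
    ∃ K, M.IsCircuit K ∧ Q ⊂ K ∧ K ⊆ Q ∪ C := by
  obtain ⟨K, hK, hQK, hKQ⟩ := h.1.exists_subset_isCircuit_of_contract
  exact ⟨K, hK, hQK.ssubset_of_ne fun h' => hK.not_indep (h' ▸ h.2), hKQ⟩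

/-- If the circuit made of the ear `Q` and a part of `C` misses `e`, it can be exchanged with `C`
by strong circuit elimination. -/
lemma IsEar.exists_isCircuit_superset_mem (h : IsEar M C Q) (hC : M.IsCircuit C) (heC : e ∈ C) :
    ∃ K, M.IsCircuit K ∧ Q ⊆ K ∧ K ⊆ Q ∪ C ∧ e ∈ K := by
  obtain ⟨K, hK, hQK, hKQ⟩ := h.exists_isCircuit_ssuperset
  by_cases heK : e ∈ K
  · exact ⟨K, hK, hQK.subset, hKQ, heK⟩
  obtain ⟨f, hfK, hfQ⟩ := exists_of_ssubset hQK
  have hfC : f ∈ C := (hKQ hfK).resolve_left hfQ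
  obtain ⟨K', hK'sub, hK', heK'⟩ := hC.strong_elimination hK hfC hfK heC heK
  have hK'C : ¬ K' ⊆ C := fun hsub =>
    (hK'sub ((hK'.eq_of_subset_isCircuit hC hsub).symm ▸ hfC)).2 rfl
  have hK'Q : K' \ C ⊆ Q := fun y ⟨hy, hyC⟩ =>
    (hKQ ((hK'sub hy).1.resolve_left hyC)).resolve_right hyC
  have hQ : K' \ C = Q := h.1.eq_of_dep_subset (hK'.contract_dep_of_not_subset hK'C) hK'Q
  exact ⟨K', hK', hQ ▸ sdiff_subset, sdiff_subset_iff.1 hK'Q |>.trans_eq (union_comm C Q), heK'⟩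

lemma IsEar.exists_isCircuit_mem [M.RankFinite] (h : IsEar M C Q) (hC : M.IsCircuit C)
    (heC : e ∈ C) (he : M.IsNonloop e) (hQ : (M ／ {e}).Indep Q) :
    ∃ K, M.IsCircuit K ∧ e ∈ K ∧ K ⊆ Q ∪ C ∧ Q.ncard + 2 ≤ K.ncard := by
  obtain ⟨K, hK, hQK, hKQ, heK⟩ := h.exists_isCircuit_superset_mem hC heC
  obtain ⟨heQ, hindep⟩ := he.contractElem_indep_iff.1 hQ
  have hss : insert e Q ⊂ K := (insert_subset heK hQK).ssubset_of_ne
    fun h' => hK.not_indep (h' ▸ hindep)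
  have hlt := ncard_lt_ncard hss hK.finite
  rw [ncard_insert_of_notMem heQ h.2.finite] at hlt
  exact ⟨K, hK, heK, hKQ, hlt⟩

lemma IsSeparator.contract_indep [M.RankFinite] (hF : IsSeparator M F) {I G : Set α}
    (hI : M.Indep I) (hIF : I ⊆ F) (hG : Disjoint G F) (hGE : G ⊆ M.E) : (M ／ G).Indep I := by
  obtain ⟨J, hJ⟩ := M.exists_isBasis G
  have hJF : Disjoint J F := hG.mono_left hJ.subset
  refine hJ.contract_indep_iff.2 ⟨?_, hG.mono_right hIF⟩
  refine indep_of_ncard_le_rk (hI.finite.union hJ.indep.finite) ?_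
  have hinter : (I ∪ J) ∩ F = I := by
    rw [union_inter_distrib_right, inter_eq_left.2 hIF, hJF.inter_eq, union_empty]
  have hsdiff : (I ∪ J) \ F = J := by
    rw [union_sdiff_distrib, sdiff_eq_empty.2 hIF, hJF.sdiff_eq_left, empty_union]
  rw [← hF.rk_inter_add (union_subset hI.subset_ground hJ.indep.subset_ground), hinter, hsdiff,
    rk_eq_ncard_of_indep hI, rk_eq_ncard_of_indep hJ.indep]
  exact ncard_union_le I J

lemma IsSeparator.contract_isCircuit [M.RankFinite] (hF : IsSeparator M F) (hK : M.IsCircuit K)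
    (hKF : K ⊆ F) {G : Set α} (hG : Disjoint G F) (hGE : G ⊆ M.E) : (M ／ G).IsCircuit K :=
  isCircuit_iff_forall_ssubset.2 ⟨hK.contract_dep (hG.mono_right hKF), fun _ hI =>
    hF.contract_indep (hK.ssubset_indep hI) (hI.subset.trans hKF) hG hGE⟩

lemma isEar_of_isSeparator [M.RankFinite] (hF : IsSeparator (M ／ {e}) F) (hK : M.IsCircuit K)
    (hKn : K.Nontrivial) (heK : e ∈ K) (hKF : K \ {e} ⊆ F) (heC : e ∈ C) (hC : C ⊆ M.E)
    (hCF : Disjoint (C \ {e}) F) : IsEar M C (K \ {e}) := by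
  refine ⟨?_, hK.sdiff_singleton_indep heK⟩
  have hcirc := hF.contract_isCircuit (hK.contractElem_isCircuit hKn heK) hKF hCF
    (sdiff_subset_sdiff_left hC)
  rwa [contract_contract, union_sdiff_self,
    union_eq_self_of_subset_left (singleton_subset_iff.2 heC)] at hcirc

/-- An element parallel to `e` becomes a loop, hence a separator, when `e` is contracted. -/
lemma isSeparator_of_parallel [M.RankFinite] (hxe : x ≠ e) (hC : M.IsCircuit {e, x}) :
    IsSeparator (M ／ {e}) ((M.E \ {e}) \ {x}) := by
  have hx := hC.mem_closure_sdiff_singleton_of_mem (e := x) (by simp)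
  rw [pair_sdiff_right hxe.symm] at hx
  have hloop : (M ／ {e}).IsLoop x := (contract_isLoop_iff_mem_closure ..).2 ⟨hx, hxe⟩
  exact (isSeparator_singleton_of_isLoop hloop).compl

end Ears

section Inputs

/-- The inputs of the routine for which `C` and `e` are relevant, that is, all inputs but
one-element matroids with arbitrary `C` and `e`. -/
structure IsProperInput (M : Matroid α) (C : Set α) (e : α) : Prop where
  isConnected : IsConnected M
  isCircuit : M.IsCircuit C
  mem : e ∈ C

lemma IsInput.isProperInput_or_eRank_le_one (h : IsInput M C e) :
    IsProperInput M C e ∨ M.eRank ≤ 1 := by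
  rcases h with ⟨hM, ⟨hC, he, -⟩ | hE⟩
  · exact .inl ⟨hM, hC, he⟩
  · exact .inr (hE ▸ M.eRank_le_encard_ground)

lemma IsInput.isProperInput (h : IsInput M C e) (hr : 2 ≤ M.eRank) : IsProperInput M C e :=
  h.isProperInput_or_eRank_le_one.resolve_right fun hr' => absurd (hr.trans hr') (by norm_num)

lemma IsConnected.exists_isInput [M.RankFinite] (h : IsConnected M) (he : e ∈ M.E) :
    ∃ C, IsInput M C e := by
  by_cases hE : M.E = {e}
  · exact ⟨∅, h, .inr (hE ▸ encard_singleton e)⟩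
  · obtain ⟨C, hC, heC⟩ := h.exists_isCircuit_mem he hE
    refine ⟨C, h, .inl ⟨hC, heC, isNonloop_of_not_isLoop he fun hloop => ?_⟩⟩
    rcases isConnected_iff.1 h _ (isSeparator_singleton_of_isLoop hloop) with h' | h'
    · exact singleton_ne_empty e h'
    · exact hE h'.symm

lemma IsProperInput.isNonloop [M.RankFinite] (h : IsProperInput M C e) (hr : 1 ≤ M.eRank) :
    M.IsNonloop e :=
  h.isConnected.isNonloop hr (h.isCircuit.subset_ground h.mem)

lemma isCircuit_contract_of_isNonloop (hC : M.IsCircuit C) (he : M.IsNonloop e) (heC : e ∈ C) :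
    (M ／ {e}).IsCircuit (C \ {e}) :=
  hC.contractElem_isCircuit (nontrivial_of_isCircuit_of_isNonloop hC he heC) heC

lemma IsProperInput.step2 (h : IsProperInput M C e) (hs : Step2 M C e C') :
    IsProperInput M C' e :=
  ⟨h.isConnected, hs.2.2.1, hs.2.2.2.2⟩

lemma IsProperInput.step3 [M.RankFinite] (h : IsProperInput M C e) (hs : Step3 M C e e₁) :
    IsProperInput (M ／ {e}) (C \ {e}) e₁ :=
  ⟨hs.2.2.1, isCircuit_contract_of_isNonloop h.isCircuit (h.isNonloop (one_le_two.trans hs.1))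
    h.mem, hs.2.2.2⟩

lemma Choice45.exists_isCircuit (h : Choice45 M C e F D g) (hC : M.IsCircuit C) (heC : e ∈ C) :
    ∃ C₁, M.IsCircuit C₁ ∧ e ∈ C₁ ∧ D = C₁ \ {e} ∧ D ⊆ F ∧ g ∈ D ∧ (C₁ = C ∨ Disjoint C F) := by
  rcases h with ⟨hCF, rfl, hg⟩ | ⟨hFC, C', hC', hsub, he, rfl, hg⟩
  · exact ⟨C, hC, heC, rfl, hCF, hg, .inl rfl⟩
  · exact ⟨C', hC', he, rfl, sdiff_singleton_subset_iff.2 hsub, hg, .inr hFC.symm⟩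

lemma IsProperInput.step45 [M.RankFinite] (h : IsProperInput M C e) (hs : Step45 M C e)
    (F : Component (M ／ {e})) (hD : Choice45 M C e F.1 D g) :
    IsProperInput ((M ／ {e}) ↾ F.1) D g := by
  obtain ⟨C₁, hC₁, heC₁, rfl, hsub, hg, -⟩ := hD.exists_isCircuit h.isCircuit h.mem
  have hcirc :=
    isCircuit_contract_of_isNonloop hC₁ (h.isNonloop (one_le_two.trans hs.1)) heC₁
  exact ⟨F.2.1.2.2, hcirc.isCircuit_restrict_of_subset hsub, hg⟩

lemma IsProperInput.exists_step2 [M.RankFinite] (h : IsProperInput M C e) (hr : 2 ≤ M.eRank)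
    (hC : C.encard = 2) : ∃ C', Step2 M C e C' := by
  obtain ⟨C', hC', hcard, he⟩ :=
    h.isConnected.exists_isCircuit_three_le hr (h.isCircuit.subset_ground h.mem)
  exact ⟨C', hr, hC, hC', hcard, he⟩

lemma IsProperInput.exists_step3 [M.RankFinite] (h : IsProperInput M C e) (hr : 2 ≤ M.eRank)
    (hC : C.encard ≠ 2) (hconn : IsConnected (M ／ {e})) : ∃ e₁, Step3 M C e e₁ := by
  obtain ⟨e₁, he₁⟩ := (isCircuit_contract_of_isNonloop h.isCircuit
    (h.isNonloop (one_le_two.trans hr)) h.mem).nonempty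
  exact ⟨e₁, hr, hC, hconn, he₁⟩

lemma IsProperInput.exists_choice45 [M.Finite] (h : IsProperInput M C e) (hr : 2 ≤ M.eRank)
    (F : Component (M ／ {e})) : ∃ D g, Choice45 M C e F.1 D g := by
  have hnl := h.isNonloop (one_le_two.trans hr)
  have hcirc := isCircuit_contract_of_isNonloop h.isCircuit hnl h.mem
  rcases F.2.subset_or_disjoint_of_isCircuit hcirc with hsub | hdisj
  · obtain ⟨g, hg⟩ := hcirc.nonempty
    exact ⟨_, g, .inl ⟨hsub, rfl, hg⟩⟩
  · have hFC : Disjoint F.1 C := disjoint_right.2 fun y hyC hy =>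
      disjoint_left.1 hdisj ⟨hyC, (F.2.1.1 hy).2⟩ hy
    obtain ⟨C', hC', hsub, he⟩ := h.isConnected.exists_isCircuit_of_component hnl F.2
    obtain ⟨g, hg⟩ := (isCircuit_contract_of_isNonloop hC' hnl he).nonempty
    exact ⟨_, g, .inr ⟨hFC, C', hC', hsub, he, rfl, hg⟩⟩

end Inputs

section Termination

/-- The parameters the routine can run on: those of a call on a finite matroid, proper unless the
routine returns at once. -/
def IsValidCall (s : Matroid α × Set α × α) : Prop :=
  s.1.Finite ∧ (2 ≤ s.1.eRank → IsProperInput s.1 s.2.1 s.2.2)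

/-- The quantity that decreases with every recursive call. Step 2 keeps the matroid, but it is never
taken twice in a row. -/
noncomputable def callMeasure (s : Matroid α × Set α × α) : ℕ :=
  open Classical in 2 * s.1.E.ncard + if s.2.1.encard = 2 then 1 else 0

lemma callMeasure_lt_of_ncard_lt {s s' : Matroid α × Set α × α}
    (h : s'.1.E.ncard < s.1.E.ncard) : callMeasure s' < callMeasure s := by
  simp only [callMeasure]
  split_ifs <;> omega

lemma Step2.encard_ne_two (hs : Step2 M C e C') : C'.encard ≠ 2 := fun h =>
  absurd (h ▸ hs.2.2.2.1) (by norm_num)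

lemma Calls.two_le_eRank {s s' : Matroid α × Set α × α} (h : Calls s s') : 2 ≤ s.1.eRank := by
  cases h with
  | step2 _ _ _ _ hs => exact hs.1
  | step3 _ _ _ _ hs => exact hs.1
  | step45 _ _ _ _ _ _ hs => exact hs.1

lemma IsValidCall.of_calls {s s' : Matroid α × Set α × α} (h : IsValidCall s) (hs : Calls s s') :
    IsValidCall s' := by
  obtain ⟨_, hp⟩ := h
  replace hp := hp hs.two_le_eRank
  cases hs with
  | step2 _ _ _ _ hs => exact ⟨‹_›, fun _ => hp.step2 hs⟩
  | step3 _ _ _ _ hs => exact ⟨inferInstance, fun _ => hp.step3 hs⟩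
  | step45 _ _ _ F _ _ hs hD => exact ⟨F.finite_restrict, fun _ => hp.step45 hs F hD⟩

lemma IsValidCall.callMeasure_lt {s s' : Matroid α × Set α × α} (h : IsValidCall s)
    (hs : Calls s s') : callMeasure s' < callMeasure s := by
  obtain ⟨_, hp⟩ := h
  replace hp := hp hs.two_le_eRank
  have hlt : (s.1 ／ {s.2.2}).E.ncard < s.1.E.ncard :=
    ncard_sdiff_singleton_lt_of_mem (hp.isCircuit.subset_ground hp.mem) s.1.ground_finite
  cases hs with
  | step2 M C e C' hs =>
    simp only [callMeasure, hs.2.1, hs.encard_ne_two, if_true, if_false]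
    omega
  | step3 M C e e₁ hs => exact callMeasure_lt_of_ncard_lt hlt
  | step45 M C e F D g hs hD =>
    exact callMeasure_lt_of_ncard_lt
      ((ncard_le_ncard F.2.1.1 (M ／ {e}).ground_finite).trans_lt hlt)

theorem IsValidCall.acc {s : Matroid α × Set α × α} (h : IsValidCall s) :
    Acc (fun s' s => Calls s s') s := by
  induction hm : callMeasure s using Nat.strong_induction_on generalizing s with
  | _ m ih =>
    subst hm
    exact .intro s fun s' hs => ih _ (h.callMeasure_lt hs) (h.of_calls hs) rfl

lemma exists_construct_of_eRank_le_one (C : Set α) (e : α) (hr : M.eRank ≤ 1) :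
    ∃ (T : Tree.{u}) (f : α → T.V), Construct M C e T f := by
  rcases hr.lt_or_eq with hr | hr
  · exact ⟨Tree.single, fun _ => Tree.single.root,
      .step0 M C e _ (Order.lt_one_iff.1 hr) fun _ _ => rfl⟩
  · exact ⟨Tree.single.addRoot, fun _ => some Tree.single.root, .step1 M C e _ hr fun _ _ => rfl⟩

lemma Step3.exists_construct {T' : Tree.{u}} {f' : α → T'.V} (hs : Step3 M C e e₁)
    (hc : Construct (M ／ {e}) (C \ {e}) e₁ T' f') :
    ∃ (T : Tree.{u}) (f : α → T.V), Construct M C e T f := by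
  classical
  let f : α → T'.addRoot.V := Function.update (fun x => some (f' x)) e (some T'.root)
  exact ⟨_, f, .step3 M C e e₁ T' f' f hs hc (Function.update_self ..)
    fun x hx => Function.update_of_ne hx.2 ..⟩

lemma Step45.exists_construct [M.Finite] {D : Component (M ／ {e}) → Set α}
    {g : Component (M ／ {e}) → α} {T : Component (M ／ {e}) → Tree.{u}} {h : ∀ F, α → (T F).V}
    (hs : Step45 M C e) (hD : ∀ F, Choice45 M C e F.1 (D F) (g F))
    (hc : ∀ F, Construct ((M ／ {e}) ↾ F.1) (D F) (g F) (T F) (h F)) :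
    ∃ (T : Tree.{u}) (f : α → T.V), Construct M C e T f := by
  obtain ⟨f, hf, hfe⟩ := exists_forall_component_eq (M := M ／ {e})
    (fun F x => some (Tree.glueIn T F (h F x))) (some (Tree.glue T).root)
  exact ⟨(Tree.glue T).addRoot, f, .step45 M C e D g T h f hs hD hc (hfe e fun he => he.2 rfl) hf⟩

theorem IsValidCall.exists_construct {s : Matroid α × Set α × α} (h : IsValidCall s) :
    ∃ (T : Tree.{u}) (f : α → T.V), Construct s.1 s.2.1 s.2.2 T f := by
  induction h.acc with
  | intro s _ ih =>
  replace ih s' (hs : Calls s s') := ih s' hs (h.of_calls hs)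
  obtain ⟨M, C, e⟩ := s
  obtain ⟨_ : M.Finite, hp⟩ := h
  rcases le_or_gt M.eRank 1 with hr | hr
  · exact exists_construct_of_eRank_le_one C e hr
  replace hr : 2 ≤ M.eRank := Order.add_one_le_of_lt hr
  replace hp : IsProperInput M C e := hp hr
  by_cases hC : C.encard = 2
  · obtain ⟨C', hs⟩ := hp.exists_step2 hr hC
    obtain ⟨T, f, hc⟩ := ih _ (.step2 M C e C' hs)
    exact ⟨T, f, .step2 M C e C' T f hs hc⟩
  by_cases hconn : IsConnected (M ／ {e})
  · obtain ⟨e₁, hs⟩ := hp.exists_step3 hr hC hconn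
    obtain ⟨T, f, hc⟩ := ih _ (.step3 M C e e₁ hs)
    exact hs.exists_construct hc
  · have hs : Step45 M C e := ⟨hr, hC, hconn⟩
    choose D g hD using hp.exists_choice45 hr
    choose T f hc using fun F => ih _ (.step45 M C e F (D F) (g F) hs (hD F))
    exact hs.exists_construct hD hc

theorem IsInput.alwaysReturns [M.Finite] (h : IsInput M C e) : AlwaysReturns M C e := by
  have hvalid : IsValidCall (M, C, e) := ⟨‹_›, h.isProperInput⟩
  refine ⟨hvalid.acc, fun s hs => IsValidCall.exists_construct ?_⟩
  induction hs with
  | refl => exact hvalid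
  | tail _ hs ih => exact ih.of_calls hs

theorem exists_constructAll (M : Matroid α) [M.Finite] :
    ∃ (T : Tree.{u}) (f : α → T.V), ConstructAll M T f := by
  have hfin (F : Component M) : (M ↾ F.1).Finite := F.finite_restrict
  have hinput (F : Component M) : ∃ C e, IsInput (M ↾ F.1) C e :=
    have ⟨e, he⟩ := F.2.1.2.1
    have ⟨C, hi⟩ := F.2.1.2.2.exists_isInput he
    ⟨C, e, hi⟩
  choose C e hi using hinput
  choose T h hc using fun F => (hi F).alwaysReturns.2 _ .refl
  obtain ⟨f, hf, -⟩ := exists_forall_component_eq (fun F x => Tree.glueIn T F (h F x))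
    (Tree.glue T).root
  exact ⟨Tree.glue T, f, .mk M C e T h f hi hc hf⟩

end Termination

section Decomposition

variable {T : Tree.{u}}

lemma isDepthDecomposition_single [M.RankFinite] {f : α → Tree.single.V} (hr : M.eRank = 0) :
    IsDepthDecomposition M Tree.single f := by
  rw [eRank_eq_rk, Nat.cast_eq_zero] at hr
  refine isDepthDecomposition_iff.2 ⟨hr.trans Tree.size_single.symm, fun X hX => ?_⟩
  exact (rk_mono hX).trans (hr.trans_le (Nat.zero_le _))

lemma isDepthDecomposition_single_addRoot [M.RankFinite] {f : α → Tree.single.addRoot.V}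
    (hr : M.eRank = 1) (hf : ∀ x ∈ M.E, f x = some Tree.single.root) :
    IsDepthDecomposition M Tree.single.addRoot f := by
  rw [eRank_eq_rk, Nat.cast_eq_one] at hr
  refine isDepthDecomposition_iff.2
    ⟨by rw [hr, Tree.size_addRoot, Tree.size_single], fun X hX => ?_⟩
  rcases X.eq_empty_or_nonempty with rfl | ⟨x, hx⟩
  · simp only [rk_empty, Nat.zero_le]
  have hpath := Tree.single.ncard_ancestors_addRoot (singleton_nonempty Tree.single.root)
    (S' := f '' X) (by rintro _ ⟨w, rfl, rfl⟩; exact ⟨x, hx, hf x (hX hx)⟩)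
  have hrk : rk M X ≤ rk M M.E := rk_mono hX
  omega

lemma IsDepthDecomposition.glue [M.Finite] {T : Component M → Tree.{u}}
    {h : ∀ F, α → (T F).V} {f : α → (Tree.glue T).V}
    (hd : ∀ F, IsDepthDecomposition (M ↾ F.1) (T F) (h F))
    (hf : ∀ F, ∀ x ∈ F.1, f x = Tree.glueIn T F (h F x)) :
    IsDepthDecomposition M (Tree.glue T) f := by
  have := Fintype.ofFinite (Component M)
  have := fun F : Component M => F.finite_restrict
  have hd' := fun F => isDepthDecomposition_iff.1 (hd F)
  refine isDepthDecomposition_iff.2 ⟨?_, fun X hX => ?_⟩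
  · rw [rk_ground_eq_sum, Tree.size_glue]
    refine Finset.sum_congr rfl fun F _ => ?_
    rw [← (hd' F).1, restrict_ground_eq, rk_restrict subset_rfl]
  · calc rk M X
      _ ≤ ∑ F : Component M, rk M (X ∩ F.1) := rk_le_sum hX
      _ ≤ ∑ F : Component M, ((T F).ancestors (h F '' (X ∩ F.1))).ncard :=
          Finset.sum_le_sum fun F _ =>
            (rk_restrict inter_subset_right).symm.trans_le ((hd' F).2 _ inter_subset_right)
      _ ≤ ((Tree.glue T).ancestors (f '' X)).ncard := by
          refine Tree.sum_ncard_ancestors_le_glue T _ fun F => ?_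
          rintro _ ⟨_, ⟨x, hx, rfl⟩, rfl⟩
          exact ⟨x, hx.1, hf F x hx.2⟩

lemma IsDepthDecomposition.addRoot [M.RankFinite] (he : M.IsNonloop e) {f' : α → T.V}
    (hd : IsDepthDecomposition (M ／ {e}) T f') {f : α → T.addRoot.V}
    (hfe : f e = some T.root) (hf : ∀ x ∈ M.E \ {e}, f x = some (f' x)) :
    IsDepthDecomposition M T.addRoot f := by
  obtain ⟨hrank, hle⟩ := isDepthDecomposition_iff.1 hd
  refine isDepthDecomposition_iff.2
    ⟨by rw [← rk_contract_ground he, hrank, T.size_addRoot], fun X hX => ?_⟩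
  rcases X.eq_empty_or_nonempty with rfl | ⟨x, hx⟩
  · simp only [rk_empty, Nat.zero_le]
  have hsub : X \ {e} ⊆ M.E \ {e} := sdiff_subset_sdiff_left hX
  let S : Set T.V := {w | (some w : Option T.V) ∈ f '' X}
  have hS : S.Nonempty := by
    by_cases hxe : x = e
    · exact ⟨T.root, x, hx, hxe ▸ hfe⟩
    · exact ⟨f' x, x, hx, hf x ⟨hX hx, hxe⟩⟩
  have hfS : f' '' (X \ {e}) ⊆ S := by
    rintro _ ⟨y, hy, rfl⟩
    exact ⟨y, hy.1, hf y (hsub hy)⟩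
  calc rk M X
    _ ≤ rk M (insert e (X \ {e})) := rk_mono (by
        rw [insert_sdiff_singleton]; exact subset_insert e X)
    _ = rk (M ／ {e}) (X \ {e}) + 1 := (rk_contract he hsub).symm
    _ ≤ (T.ancestors (f' '' (X \ {e}))).ncard + 1 := Nat.succ_le_succ (hle _ hsub)
    _ ≤ (T.ancestors S).ncard + 1 := Nat.succ_le_succ (ncard_le_ncard (T.ancestors_mono hfS))
    _ ≤ (T.addRoot.ancestors (f '' X)).ncard :=
        T.ncard_ancestors_addRoot hS (image_subset_iff.2 fun _ hw => hw)

theorem Construct.isDepthDecomposition {f : α → T.V} (h : Construct M C e T f)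
    (hvalid : IsValidCall (M, C, e)) : IsDepthDecomposition M T f := by
  induction h with
  | step0 M C e f hr =>
    have : M.Finite := hvalid.1
    exact isDepthDecomposition_single hr
  | step1 M C e f hr hf =>
    have : M.Finite := hvalid.1
    exact isDepthDecomposition_single_addRoot hr hf
  | step2 M C e C' _ _ hs _ ih => exact ih (hvalid.of_calls (.step2 M C e C' hs))
  | step3 M C e e₁ T' f' f hs _ hfe hf ih =>
    have : M.Finite := hvalid.1
    exact (ih (hvalid.of_calls (.step3 M C e e₁ hs))).addRoot
      ((hvalid.2 hs.1).isNonloop (one_le_two.trans hs.1)) hfe hf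
  | step45 M C e D g T h f hs hD _ hfe hf ih =>
    have : M.Finite := hvalid.1
    obtain ⟨f', hf', -⟩ := exists_forall_component_eq (M := M ／ {e})
      (fun F x => Tree.glueIn T F (h F x)) (Tree.glue T).root
    have hglue : IsDepthDecomposition (M ／ {e}) (Tree.glue T) f' := .glue
      (fun F => ih F (hvalid.of_calls (.step45 M C e F (D F) (g F) hs (hD F)))) hf'
    refine hglue.addRoot ((hvalid.2 hs.1).isNonloop (one_le_two.trans hs.1)) hfe fun x hx => ?_
    obtain ⟨F, hF, hxF⟩ := exists_isComponent_mem (M := M ／ {e}) hx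
    exact (hf ⟨F, hF⟩ x hxF).trans (congrArg some (hf' ⟨F, hF⟩ x hxF).symm)

theorem ConstructAll.isDepthDecomposition [M.Finite] {f : α → T.V} (h : ConstructAll M T f) :
    IsDepthDecomposition M T f := by
  cases h with
  | mk C e T h f hi hc hf =>
    exact .glue (fun F => (hc F).isDepthDecomposition ⟨F.finite_restrict, (hi F).isProperInput⟩) hf

end Decomposition

section Depth

variable {T : Tree.{u}} {n d d' : ℕ}

/-- Every circuit of `M` has at most `n` elements. -/
def CircumferenceLE (M : Matroid α) (n : ℕ) : Prop := ∀ C, M.IsCircuit C → C.ncard ≤ n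

lemma CircumferenceLE.contract [M.RankFinite] (h : CircumferenceLE M n) :
    CircumferenceLE (M ／ C) n := fun K hK => by
  obtain ⟨K', hK', hKK', -⟩ := hK.exists_subset_isCircuit_of_contract
  exact (ncard_le_ncard hKK' hK'.finite).trans (h K' hK')

lemma CircumferenceLE.restrict (h : CircumferenceLE M n) (hR : R ⊆ M.E) :
    CircumferenceLE (M ↾ R) n := fun K hK => h K ((restrict_isCircuit_iff hR).1 hK).1

lemma IsDepthDecomposition.circumferenceLE [M.RankFinite] {f : α → T.V}
    (h : IsDepthDecomposition M T f) : CircumferenceLE M (2 ^ bd M) :=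
  fun _ hC => h.ncard_circuit_le_two_pow_bd hC

/-- The bound on the depth `d` of a tree returned for the circuit `C`: an excess over `|C| - 1` is
paid for by an ear of `C`. -/
def EarBound (M : Matroid α) (C : Set α) (n d : ℕ) : Prop :=
  d + 1 ≤ C.ncard ∨ ∃ Q, IsEar M C Q ∧ d + 1 ≤ C.ncard + Q.ncard * (n - 2)

/-- The bound on the depth `d` of a tree returned for the element `e`: an excess over `n - 1` is
paid for by a circuit in `S` through `e`. In contrast to `EarBound` it is independent of the circuit
given to the routine. -/
def CircuitBound (M : Matroid α) (S : Set α) (e : α) (n d : ℕ) : Prop :=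
  ∃ K, M.IsCircuit K ∧ e ∈ K ∧ K ⊆ S ∧ d + 1 ≤ n + (K.ncard - 2) * (n - 2)

lemma circuitBound_of_le (hC : M.IsCircuit C) (heC : e ∈ C) (hd : d + 1 ≤ n) :
    CircuitBound M M.E e n d :=
  ⟨C, hC, heC, hC.subset_ground, le_add_right hd⟩

lemma two_le_ncard_of_isCircuit [M.RankFinite] (hC : M.IsCircuit C) (he : M.IsNonloop e)
    (heC : e ∈ C) : 2 ≤ C.ncard :=
  have := hC.finite.to_subtype
  one_lt_ncard_iff_nontrivial.2 (nontrivial_of_isCircuit_of_isNonloop hC he heC)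

lemma EarBound.of_contract_restrict [M.RankFinite] (h : EarBound ((M ／ {e}) ↾ R) (C \ {e}) n d')
    (hR : R ⊆ M.E \ {e}) (hC : M.IsCircuit C) (heC : e ∈ C) (hCR : C \ {e} ⊆ R)
    (hd : d ≤ d' + 1) : EarBound M C n d := by
  have hcard := ncard_sdiff_singleton_add_one heC hC.finite
  rcases h with h | ⟨Q, hQ, h⟩
  · exact .inl (by omega)
  · exact .inr ⟨Q, (hQ.of_contract_restrict hR heC hCR).1, by omega⟩

lemma EarBound.circuitBound [M.RankFinite] (h : EarBound ((M ／ {e}) ↾ R) (C \ {e}) n d')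
    (hR : R ⊆ M.E \ {e}) (hC : M.IsCircuit C) (heC : e ∈ C) (hCR : C \ {e} ⊆ R)
    (he : M.IsNonloop e) (hn : CircumferenceLE M n) (hd : d ≤ d' + 1) :
    CircuitBound M (insert e R) e n d := by
  have hcard := ncard_sdiff_singleton_add_one heC hC.finite
  have hCn := hn C hC
  have hCeR : C ⊆ insert e R := sdiff_singleton_subset_iff.1 hCR
  rcases h with h | ⟨Q, hQ, h⟩
  · exact ⟨C, hC, heC, hCeR, le_add_right (by omega)⟩
  · obtain ⟨hear, hindep⟩ := hQ.of_contract_restrict hR heC hCR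
    have hQR : Q ⊆ R := hQ.2.subset_ground
    obtain ⟨K, hK, heK, hKQ, hQK⟩ := hear.exists_isCircuit_mem hC heC he hindep
    refine ⟨K, hK, heK, hKQ.trans (union_subset (hQR.trans (subset_insert e R)) hCeR), ?_⟩
    calc d + 1 ≤ n + Q.ncard * (n - 2) := by omega
      _ ≤ n + (K.ncard - 2) * (n - 2) := by gcongr; omega

lemma CircuitBound.earBound [M.RankFinite] (h : CircuitBound M (insert e F) e n d)
    (hF : IsSeparator (M ／ {e}) F) (hC : M.IsCircuit C) (heC : e ∈ C)
    (hCF : Disjoint (C \ {e}) F) (he : M.IsNonloop e) : EarBound M C n d := by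
  obtain ⟨K, hK, heK, hKF, hd⟩ := h
  have hC2 := two_le_ncard_of_isCircuit hC he heC
  have hK2 := two_le_ncard_of_isCircuit hK he heK
  refine .inr ⟨K \ {e}, isEar_of_isSeparator hF hK
    (nontrivial_of_isCircuit_of_isNonloop hK he heK) heK (sdiff_singleton_subset_iff.2 hKF) heC
    hC.subset_ground hCF, ?_⟩
  calc d + 1 ≤ n + (K.ncard - 2) * (n - 2) := hd
    _ ≤ C.ncard + (n - 2) + (K.ncard - 2) * (n - 2) := by omega
    _ = C.ncard + (K.ncard - 2 + 1) * (n - 2) := by ring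
    _ = C.ncard + (K \ {e}).ncard * (n - 2) := by
      rw [ncard_sdiff_singleton_of_mem heK]; congr 2; omega

/-- A circuit through `e` other than `C = {e, x}` avoids `x`, which is a loop of `M / e`, so
removing `e` from it leaves an ear of `C`. -/
lemma CircuitBound.earBound_of_encard_eq_two [M.RankFinite] (h : CircuitBound M M.E e n d)
    (hC : M.IsCircuit C) (heC : e ∈ C) (hC2 : C.encard = 2) (hC' : M.IsCircuit C') (heC' : e ∈ C')
    (hne : C' ≠ C) (he : M.IsNonloop e) : EarBound M C n d := by
  obtain ⟨x, hxe, rfl⟩ : ∃ x, x ≠ e ∧ C = {e, x} := by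
    obtain ⟨a, b, hab, rfl⟩ := encard_eq_two.1 hC2
    rcases heC with rfl | rfl
    · exact ⟨b, hab.symm, rfl⟩
    · exact ⟨a, hab, pair_comm a e⟩
  have hear : ∀ K, M.IsCircuit K → e ∈ K → K ≠ {e, x} →
      d + 1 ≤ n + (K.ncard - 2) * (n - 2) → EarBound M {e, x} n d := by
    intro K hK heK hKne hd
    have hxK : x ∉ K := fun hxK =>
      hKne (hC.eq_of_subset_isCircuit hK (pair_subset heK hxK)).symm
    have hKF : K \ {e} ⊆ (M.E \ {e}) \ {x} := subset_sdiff_singleton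
      (sdiff_subset_sdiff_left hK.subset_ground) fun hx => hxK hx.1
    refine CircuitBound.earBound ⟨K, hK, heK, sdiff_singleton_subset_iff.1 hKF, hd⟩
      (isSeparator_of_parallel hxe hC) hC heC ?_ he
    rw [pair_sdiff_left hxe.symm]
    exact disjoint_sdiff_right
  obtain ⟨K, hK, heK, -, hd⟩ := h
  by_cases hKC : K = {e, x}
  · rw [hKC, ncard_pair hxe.symm, Nat.sub_self, zero_mul, add_zero] at hd
    exact hear C' hC' heC' hne (le_add_right hd)
  · exact hear K hK heK hKC hd

lemma Choice45.earBound_and_circuitBound [M.Finite] {D : Set α} {g : α} {F : Component (M ／ {e})}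
    (hD : Choice45 M C e F.1 D g) (h : EarBound ((M ／ {e}) ↾ F.1) D n d') (hC : M.IsCircuit C)
    (heC : e ∈ C) (he : M.IsNonloop e) (hn : CircumferenceLE M n) (hd : d ≤ d' + 1) :
    EarBound M C n d ∧ CircuitBound M M.E e n d := by
  obtain ⟨C₁, hC₁, heC₁, rfl, hsub, -, hor⟩ := hD.exists_isCircuit hC heC
  have hFE : F.1 ⊆ M.E \ {e} := F.2.1.1
  have hbound := h.circuitBound hFE hC₁ heC₁ hsub he hn hd
  refine ⟨?_, ?_⟩
  · rcases hor with rfl | hdisj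
    · exact h.of_contract_restrict hFE hC heC hsub hd
    · exact hbound.earBound F.2.isSeparator hC heC (hdisj.mono_left sdiff_subset) he
  · obtain ⟨K, hK, heK, -, hKd⟩ := hbound
    exact ⟨K, hK, heK, hK.subset_ground, hKd⟩

lemma exists_component_depth_le [M.Finite] (hC : M.IsCircuit C) (he : M.IsNonloop e)
    (heC : e ∈ C) (T : Component (M ／ {e}) → Tree.{u}) :
    ∃ F, (Tree.glue T).addRoot.depth ≤ (T F).depth + 1 := by
  obtain ⟨x, hx⟩ := (isCircuit_contract_of_isNonloop hC he heC).nonempty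
  obtain ⟨F, hF, -⟩ := exists_isComponent_mem (M := M ／ {e}) (x := x)
    ⟨hC.subset_ground hx.1, hx.2⟩
  have : Nonempty (Component (M ／ {e})) := ⟨F, hF⟩
  obtain ⟨F, hmax⟩ := Finite.exists_max fun F => (T F).depth
  exact ⟨F, (Tree.depth_addRoot_le _).trans (Nat.succ_le_succ (Tree.depth_glue_le T hmax))⟩

theorem Construct.earBound_and_circuitBound {f : α → T.V} (h : Construct M C e T f)
    (hM : M.Finite) (hp : IsProperInput M C e) (hn : CircumferenceLE M n) :
    EarBound M C n T.depth ∧ CircuitBound M M.E e n T.depth := by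
  induction h with
  | step0 M C e =>
    have hpos : 0 < C.ncard := (ncard_pos hp.isCircuit.finite).2 hp.isCircuit.nonempty
    rw [Tree.depth_single]
    exact ⟨.inl hpos, circuitBound_of_le hp.isCircuit hp.mem (hpos.trans_le (hn C hp.isCircuit))⟩
  | step1 M C e _ hr =>
    have hdepth := Tree.single.{u}.depth_addRoot_le
    rw [Tree.depth_single] at hdepth
    have hC2 := two_le_ncard_of_isCircuit hp.isCircuit (hp.isNonloop hr.ge) hp.mem
    have hCn := hn C hp.isCircuit
    exact ⟨.inl (by omega), circuitBound_of_le hp.isCircuit hp.mem (by omega)⟩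
  | step2 M C e C' T _ hs _ ih =>
    have hbound := (ih hM (hp.step2 hs) hn).2
    have hne : C' ≠ C := fun h => hs.encard_ne_two (h ▸ hs.2.1)
    exact ⟨hbound.earBound_of_encard_eq_two hp.isCircuit hp.mem hs.2.1 hs.2.2.1 hs.2.2.2.2 hne
      (hp.isNonloop (one_le_two.trans hs.1)), hbound⟩
  | step3 M C e e₁ T' _ _ hs _ _ _ ih =>
    have he := hp.isNonloop (one_le_two.trans hs.1)
    have hear := (ih inferInstance (hp.step3 hs) hn.contract).1
    rw [← restrict_ground_eq_self (M ／ {e})] at hear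
    have hsub : C \ {e} ⊆ M.E \ {e} := sdiff_subset_sdiff_left hp.isCircuit.subset_ground
    have hbound := hear.circuitBound subset_rfl hp.isCircuit hp.mem hsub he hn T'.depth_addRoot_le
    rw [contract_ground, insert_sdiff_singleton, insert_eq_of_mem he.mem_ground] at hbound
    exact ⟨hear.of_contract_restrict subset_rfl hp.isCircuit hp.mem hsub T'.depth_addRoot_le,
      hbound⟩
  | step45 M C e D g T _ _ hs hD _ _ _ ih =>
    have he := hp.isNonloop (one_le_two.trans hs.1)
    obtain ⟨F, hF⟩ := exists_component_depth_le hp.isCircuit he hp.mem T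
    have hear := (ih F F.finite_restrict (hp.step45 hs F (hD F)) (hn.contract.restrict F.2.1.1)).1
    exact (hD F).earBound_and_circuitBound hear hp.isCircuit hp.mem he hn hF

lemma EarBound.le_sq [M.RankFinite] (h : EarBound M C n d) (hC : M.IsCircuit C)
    (hn : CircumferenceLE M n) : d ≤ n ^ 2 := by
  have hCn := hn C hC
  rcases h with h | ⟨Q, hQ, h⟩
  · exact (Nat.le_of_succ_le (h.trans hCn)).trans (Nat.le_self_pow two_ne_zero n)
  · obtain ⟨K, hK, hQK, -⟩ := hQ.exists_isCircuit_ssuperset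
    have hQn : Q.ncard + 1 ≤ n := (ncard_lt_ncard hQK hK.finite).trans_le (hn K hK)
    calc d ≤ n + Q.ncard * n := by
          have : Q.ncard * (n - 2) ≤ Q.ncard * n := by gcongr; omega
          omega
      _ = (Q.ncard + 1) * n := by ring
      _ ≤ n ^ 2 := by rw [sq]; gcongr

lemma Construct.depth_le_one {f : α → T.V} (h : Construct M C e T f) (hr : M.eRank ≤ 1) :
    T.depth ≤ 1 := by
  have hr' : ¬ 2 ≤ M.eRank := fun h => absurd (h.trans hr) (by norm_num)
  cases h with
  | step0 => exact Tree.depth_single.trans_le zero_le_one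
  | step1 => exact Tree.single.depth_addRoot_le.trans_eq (by rw [Tree.depth_single])
  | step2 _ _ _ _ _ _ hs => exact absurd hs.1 hr'
  | step3 _ _ _ _ _ _ _ hs => exact absurd hs.1 hr'
  | step45 _ _ _ _ _ _ _ _ hs => exact absurd hs.1 hr'

theorem Construct.depth_le_four_pow [M.Finite] {f : α → T.V} (h : Construct M C e T f)
    (hi : IsInput M C e) {k : ℕ} (hk : CircumferenceLE M (2 ^ k)) : T.depth ≤ 4 ^ k := by
  rcases hi.isProperInput_or_eRank_le_one with hp | hr
  · calc T.depth ≤ (2 ^ k) ^ 2 := (h.earBound_and_circuitBound ‹_› hp hk).1.le_sq hp.isCircuit hk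
      _ = 4 ^ k := pow_right_comm 2 k 2
  · exact (h.depth_le_one hr).trans (Nat.one_le_pow k 4 four_pos)

theorem ConstructAll.depth_le_four_pow [M.Finite] {f : α → T.V} (h : ConstructAll M T f) {k : ℕ}
    (hk : CircumferenceLE M (2 ^ k)) : T.depth ≤ 4 ^ k := by
  cases h with
  | mk C e T h f hi hc hf =>
    refine Tree.depth_glue_le T fun F => ?_
    have := F.finite_restrict
    exact (hc F).depth_le_four_pow (hi F) (hk.restrict F.2.1.1)

end Depth

end BranchDepth

theorem lemmal {α : Type u} (M : Matroid α) [M.Finite] :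
    (∀ (C : Set α) (e : α), BranchDepth.IsInput M C e →
      BranchDepth.AlwaysReturns M C e ∧
      ∀ (T : BranchDepth.Tree.{u}) (f : α → T.V), BranchDepth.Construct M C e T f →
        BranchDepth.IsDepthDecomposition M T f ∧ T.depth ≤ 4 ^ BranchDepth.bd M) ∧
    ((∃ (T : BranchDepth.Tree.{u}) (f : α → T.V), BranchDepth.ConstructAll M T f) ∧
      ∀ (T : BranchDepth.Tree.{u}) (f : α → T.V), BranchDepth.ConstructAll M T f →
        BranchDepth.IsDepthDecomposition M T f ∧ T.depth ≤ 4 ^ BranchDepth.bd M) := by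
  refine ⟨fun C e hi => ⟨hi.alwaysReturns, fun T f h => ?_⟩, BranchDepth.exists_constructAll M,
    fun T f h => ?_⟩
  · have hdecomp := h.isDepthDecomposition ⟨‹M.Finite›, hi.isProperInput⟩
    exact ⟨hdecomp, h.depth_le_four_pow hi hdecomp.circumferenceLE⟩
  · have hdecomp := h.isDepthDecomposition
    exact ⟨hdecomp, h.depth_le_four_pow hdecomp.circumferenceLE⟩
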